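/- Let $d\ge 1$, and let $\mathbb H^d$ be hyperbolic space of dimension $d$ (the half-space $\{x\in\mathbb R^d : x_1>0\}$ with the metric $dx^2/x_1^2$), with hyperbolic distance $\operatorname{dist}$, Riemannian volume $\mu$ and (non-positive) Laplace–Beltrami operator $\Delta$. The heat kernel of $\mathbb H^d$ is the smallest nonnegative fundamental solution $K(x,y,t)$ of the heat equation: the smallest among the nonnegative continuous functions $K$ on $\mathbb H^d\times\mathbb H^d\times(0,\infty)$ that are $C^2$ in $x$ and $C^1$ in $t$, satisfy $\partial_t K=\Delta_x K$, and satisfy $\lim_{t\downarrow 0}\int K(x,y,t)f(x)\,d\mu(x)=f(y)$ for every $y\in\mathbb H^d$ and every continuous compactly supported $f$ on $\mathbb H^d$. **Lemma.** The heat kernel of $\mathbb H^d$ exists, is unique, and depends only on the hyperbolic distance and the time: it equals $p_d(\rho,t)$ with $\rho=\operatorname{dist}(x,y)$. For each $t>0$, the function $\rho\mapsto p_d(\rho,t)$ is (strictly) decreasing on $[0,\infty)$. -/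

import Mathlib

open MeasureTheory Set Filter Topology

noncomputable section

namespace HypHeat

/-- Coordinate space of dimension `d`, with its Euclidean norm. -/
abbrev Coord (d : ℕ) : Type := EuclideanSpace ℝ (Fin d)

/-- The `i`-th partial derivative of `u` at `x`. -/
def partialDeriv {d : ℕ} (i : Fin d) (u : Coord d → ℝ) (x : Coord d) : ℝ :=
  fderiv ℝ u x (EuclideanSpace.single i 1)

/-- The Riemannian volume density `√(det g)` of a metric `g` given in coordinates. -/
def volumeDensity {d : ℕ} (g : Coord d → Matrix (Fin d) (Fin d) ℝ) (x : Coord d) : ℝ :=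
  Real.sqrt (g x).det

/-- The (non-positive) Laplace-Beltrami operator of a metric `g` given in coordinates:
`Δ u = (1 / √det g) ∑ i, ∂_i (∑ j, √det g * g^{ij} * ∂_j u)`. -/
def laplaceBeltrami {d : ℕ} (g : Coord d → Matrix (Fin d) (Fin d) ℝ)
    (u : Coord d → ℝ) (x : Coord d) : ℝ :=
  (volumeDensity g x)⁻¹ *
    ∑ i, partialDeriv i
      (fun z => ∑ j, volumeDensity g z * (g z)⁻¹ i j * partialDeriv j u z) x

variable (d : ℕ) [NeZero d]

/-- Hyperbolic space `ℍ^d` in the upper half-space model: the points whose first coordinate is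
positive. -/
def hypSpace : Set (Coord d) := {x | 0 < x 0}

/-- The hyperbolic metric `ds² = dx² / x_1²`, where `x_1` is the first coordinate. -/
def hypMetric (x : Coord d) : Matrix (Fin d) (Fin d) ℝ :=
  Matrix.diagonal (fun _ => 1 / (x 0) ^ 2)

/-- The hyperbolic distance; for `d = 2` this is the formula by which Mathlib defines the distance
on `UpperHalfPlane`. Equivalently `cosh (hypDist x y) = 1 + ‖x - y‖² / (2 x_1 y_1)`. -/
def hypDist (x y : Coord d) : ℝ :=
  2 * Real.arsinh (dist x y / (2 * Real.sqrt (x 0 * y 0)))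

/-- The Riemannian volume measure of hyperbolic space. -/
def hypVolume : Measure (Coord d) :=
  (volume.restrict (hypSpace d)).withDensity
    (fun x => ENNReal.ofReal (volumeDensity (hypMetric d) x))

/-- `K x y t` is a nonnegative fundamental solution of the heat equation `∂_t K = Δ_x K` on
`ℍ^d`: it is continuous in `(x, y, t)`, of class `C²` in `x` and `C¹` in `t`, nonnegative,
solves the equation for `t > 0`, and `K (·, y, t)` tends to the Dirac mass at `y` as `t ↓ 0`.
Only the values at `x, y ∈ ℍ^d` and `t > 0` matter. -/
structure IsFundamentalSolution (K : Coord d → Coord d → ℝ → ℝ) : Prop where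
  continuousOn : ContinuousOn (fun q : Coord d × Coord d × ℝ => K q.1 q.2.1 q.2.2)
    (hypSpace d ×ˢ hypSpace d ×ˢ Ioi (0 : ℝ))
  contDiffOn_space : ∀ y ∈ hypSpace d, ∀ t : ℝ, 0 < t →
    ContDiffOn ℝ 2 (fun x => K x y t) (hypSpace d)
  contDiffOn_time : ∀ x ∈ hypSpace d, ∀ y ∈ hypSpace d,
    ContDiffOn ℝ 1 (fun t => K x y t) (Ioi (0 : ℝ))
  nonneg : ∀ x ∈ hypSpace d, ∀ y ∈ hypSpace d, ∀ t : ℝ, 0 < t → 0 ≤ K x y t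
  heat_eq : ∀ x ∈ hypSpace d, ∀ y ∈ hypSpace d, ∀ t : ℝ, 0 < t →
    deriv (fun s => K x y s) t = laplaceBeltrami (hypMetric d) (fun z => K z y t) x
  tendsto_dirac : ∀ y ∈ hypSpace d, ∀ f : Coord d → ℝ, Continuous f → HasCompactSupport f →
    tsupport f ⊆ hypSpace d →
    Tendsto (fun t : ℝ => ∫ x, K x y t * f x ∂(hypVolume d)) (𝓝[>] 0) (𝓝 (f y))

/-- `K` is the heat kernel of `ℍ^d`: the smallest nonnegative fundamental solution of the heat
equation. -/
structure IsHeatKernel (K : Coord d → Coord d → ℝ → ℝ) : Prop where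
  isFundamentalSolution : IsFundamentalSolution d K
  minimal : ∀ K' : Coord d → Coord d → ℝ → ℝ, IsFundamentalSolution d K' →
    ∀ x ∈ hypSpace d, ∀ y ∈ hypSpace d, ∀ t : ℝ, 0 < t → K x y t ≤ K' x y t

end HypHeat

end

/-!
In the variable `u = cosh ρ`, the heat kernel of dimension `d + 2` is, up to an exponential factor
in time, `-1/(2π)` times the derivative of the one of dimension `d`, and the one of dimension `d` is
the Abel transform (the integral over a family of horocycles) of the one of dimension `d + 1`.
Starting from the Gaussian in dimension one, this gives an explicit kernel in every dimension.
The square of `arcosh u` has the derivative `2 arcosh u / √(u² - 1)`, which is completely monotone.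
Hence so is the Gaussian as a function of `u`: the kernels are positive, and each is strictly
decreasing because its derivative is minus a positive multiple of the kernel two dimensions up.

Integrating over horospheres reduces the total mass to that of a Gaussian on the line, with a drift
that the exponential factor compensates; the same computation shows that the mass concentrates on
the diagonal as `t ↓ 0`.

For the minimality, let `K` be a nonnegative fundamental solution and cut `K(·, y, s)` off to a
compactly supported `g ≤ K(·, y, s)`. The heat flow of `g` vanishes at infinity, so by the minimum
principle it stays below `K(·, y, s + t)`. Let `s ↓ 0`: then `g` tends to the Dirac mass at `y`, and
its heat flow to the explicit kernel.
-/

noncomputable section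

namespace HypHeat

section Calculus

variable {E : Type*} [NormedAddCommGroup E] [NormedSpace ℝ E]

lemma hasDerivAt_setIntegral_of_continuousOn {α : Type*} [TopologicalSpace α] [T2Space α]
    [MeasurableSpace α] [BorelSpace α] {μ : Measure α} {V : Set ℝ} {K : Set α} {f f' : ℝ → α → E}
    {s₀ : ℝ} (hV : IsOpen V) (hs₀ : s₀ ∈ V) (hK : IsCompact K) (hμ : μ K ≠ ⊤)
    (hf : ContinuousOn ↿f (V ×ˢ K)) (hf' : ContinuousOn ↿f' (V ×ˢ K))
    (hderiv : ∀ s ∈ V, ∀ z ∈ K, HasDerivAt (fun s => f s z) (f' s z) s) :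
    HasDerivAt (fun s => ∫ z in K, f s z ∂μ) (∫ z in K, f' s₀ z ∂μ) s₀ := by
  obtain ⟨r, hr, hrV⟩ := Metric.nhds_basis_closedBall.mem_iff.1 (hV.mem_nhds hs₀)
  have hslice {h : ℝ → α → E} (hh : ContinuousOn ↿h (V ×ˢ K)) {s : ℝ} (hs : s ∈ V) :
      ContinuousOn (h s) K := hh.comp (f := fun z => (s, z)) (by fun_prop) fun z hz => ⟨hs, hz⟩
  have hmeas {h : ℝ → α → E} (hh : ContinuousOn ↿h (V ×ˢ K)) {s : ℝ} (hs : s ∈ V) :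
      AEStronglyMeasurable (h s) (μ.restrict K) :=
    (hslice hh hs).aestronglyMeasurable_of_isCompact hK hK.measurableSet
  have hae {P : α → Prop} (hP : ∀ z ∈ K, P z) : ∀ᵐ z ∂μ.restrict K, P z :=
    (ae_restrict_iff' hK.measurableSet).2 (ae_of_all _ hP)
  obtain ⟨C, hC⟩ := hK.exists_bound_of_continuousOn (hslice hf hs₀)
  obtain ⟨C', hC'⟩ := ((isCompact_closedBall s₀ r).prod hK).exists_bound_of_continuousOn
    (hf'.mono (prod_mono hrV le_rfl))
  refine (hasDerivAt_integral_of_dominated_loc_of_deriv_le (bound := fun _ => C')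
    (Metric.closedBall_mem_nhds s₀ hr) ?_ ?_ (hmeas hf' hs₀) ?_ (integrableOn_const hμ) ?_).2
  · filter_upwards [hV.mem_nhds hs₀] with s hs using hmeas hf hs
  · exact (integrableOn_const (C := C) hμ).mono' (hmeas hf hs₀) (hae hC)
  · exact hae fun z hz s hs => hC' (s, z) ⟨hs, hz⟩
  · exact hae fun z hz s hs => hderiv s (hrV hs) z hz

/-- The time integral of `R` recovers the increments of `f`, so differentiating it in `x` under the
integral sign recovers the increments of `g`. -/
lemma hasDerivAt_partial_comm [CompleteSpace E] {f g R S : ℝ → ℝ → E} {U V : Set ℝ}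
    (hU : IsOpen U) (hV : IsOpen V)
    (hf : ∀ x ∈ U, ∀ t ∈ V, HasDerivAt (fun x => f x t) (g x t) x)
    (hR : ∀ x ∈ U, ∀ t ∈ V, HasDerivAt (fun t => f x t) (R x t) t)
    (hS : ∀ x ∈ U, ∀ t ∈ V, HasDerivAt (fun x => R x t) (S x t) x)
    (hRc : ContinuousOn ↿R (U ×ˢ V)) (hSc : ContinuousOn ↿S (U ×ˢ V))
    {x t : ℝ} (hx : x ∈ U) (ht : t ∈ V) : HasDerivAt (fun t => g x t) (S x t) t := by
  obtain ⟨a, b, -, hab, habV⟩ := exists_Icc_mem_subset_of_mem_nhds (hV.mem_nhds ht)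
  obtain ⟨hat, htb⟩ := Icc_mem_nhds_iff.1 hab
  have hslice {h : ℝ → ℝ → E} (hh : ContinuousOn ↿h (U ×ˢ V)) {x : ℝ} (hx : x ∈ U) :
      ContinuousOn (h x) V := hh.comp (f := fun t => (x, t)) (by fun_prop) fun z hz => ⟨hx, hz⟩
  have increment : ∀ τ ∈ Ioo a b, g x τ = g x a + ∫ r in a..τ, S x r := by
    intro τ ⟨haτ, hτb⟩
    have hsub : Icc a τ ⊆ V := (Icc_subset_Icc_right hτb.le).trans habV
    have haV : a ∈ V := hsub (left_mem_Icc.2 haτ.le)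
    have hτV : τ ∈ V := hsub (right_mem_Icc.2 haτ.le)
    have hFTC : (fun y => f y τ - f y a) =ᶠ[𝓝 x] fun y => ∫ r in Icc a τ, R y r := by
      filter_upwards [hU.mem_nhds hx] with y hy
      rw [integral_Icc_eq_integral_Ioc, ← intervalIntegral.integral_of_le haτ.le]
      refine (intervalIntegral.integral_eq_sub_of_hasDerivAt_of_le haτ.le ?_
        (fun r hr => hR y hy r (hsub (Ioo_subset_Icc_self hr))) ?_).symm
      · exact fun r hr => (hR y hy r (hsub hr)).continuousAt.continuousWithinAt
      · exact ((hslice hRc hy).mono hsub).intervalIntegrable_of_Icc haτ.le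
    have hint : HasDerivAt (fun y => ∫ r in Icc a τ, R y r) (∫ r in Icc a τ, S x r) x :=
      hasDerivAt_setIntegral_of_continuousOn hU hx isCompact_Icc (by simp)
        (hRc.mono (prod_mono le_rfl hsub)) (hSc.mono (prod_mono le_rfl hsub))
        fun y hy r hr => hS y hy r (hsub hr)
    have hg := ((hf x hx τ hτV).sub (hf x hx a haV)).unique (hint.congr_of_eventuallyEq hFTC)
    rw [integral_Icc_eq_integral_Ioc, ← intervalIntegral.integral_of_le haτ.le] at hg
    rw [← hg, add_sub_cancel]
  have hSx := hslice hSc hx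
  have hprim : HasDerivAt (fun τ => g x a + ∫ r in a..τ, S x r) (S x t) t :=
    (intervalIntegral.integral_hasDerivAt_right
      ((hSx.mono ((Icc_subset_Icc_right htb.le).trans habV)).intervalIntegrable_of_Icc hat.le)
      (hSx.stronglyMeasurableAtFilter hV t ht) (hSx.continuousAt (hV.mem_nhds ht))).const_add _
  refine hprim.congr_of_eventuallyEq ?_
  filter_upwards [Ioo_mem_nhds hat htb] with τ hτ using increment τ hτ

section DerivativeSequence

variable {f : ℕ → ℝ → E} {s : Set ℝ}

lemma eqOn_iteratedDeriv_of_forall_hasDerivAt (hs : IsOpen s)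
    (hf : ∀ k, ∀ x ∈ s, HasDerivAt (f k) (f (k + 1) x) x) (k : ℕ) :
    EqOn (iteratedDeriv k (f 0)) (f k) s := by
  induction k with
  | zero => exact fun x _ => by rw [iteratedDeriv_zero]
  | succ k ih =>
    intro x hx
    rw [iteratedDeriv_succ, (ih.eventuallyEq_of_mem (hs.mem_nhds hx)).deriv_eq, (hf k x hx).deriv]

lemma contDiffOn_of_forall_hasDerivAt (hs : IsOpen s)
    (hf : ∀ k, ∀ x ∈ s, HasDerivAt (f k) (f (k + 1) x) x) (n : ℕ) : ContDiffOn ℝ n (f 0) s := by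
  induction n generalizing f with
  | zero => exact contDiffOn_zero.2 fun x hx => (hf 0 x hx).continuousAt.continuousWithinAt
  | succ n ih =>
    rw [Nat.cast_add_one, contDiffOn_succ_iff_deriv_of_isOpen hs]
    refine ⟨fun x hx => (hf 0 x hx).differentiableAt.differentiableWithinAt, by simp, ?_⟩
    exact (ih (f := fun k => f (k + 1)) fun k => hf (k + 1)).congr fun x hx => (hf 0 x hx).deriv

end DerivativeSequence

end Calculus

/-- `(-1)^k` times the `k`-th derivative of `arcosh u / √(u² - 1)`, which is smooth on `(0, ∞)`: the
integral representation `∫₀¹ 2 / (x² + 2xu + 1) dx` of that function has no singularity at `u = 1`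
and makes all the signs visible. -/
def arcoshQuotDeriv (k : ℕ) (u : ℝ) : ℝ :=
  ∫ x in Icc (0 : ℝ) 1, 2 * (k.factorial * (2 * x) ^ k / (x ^ 2 + 2 * x * u + 1) ^ (k + 1))

lemma one_le_sq_add_two_mul_add_one {x u : ℝ} (hx : 0 ≤ x) (hu : 0 < u) :
    1 ≤ x ^ 2 + 2 * x * u + 1 := by
  have : 0 ≤ x ^ 2 + 2 * x * u := by positivity
  linarith

lemma continuousOn_arcoshQuotDeriv_integrand (k : ℕ) :
    ContinuousOn (fun q : ℝ × ℝ => 2 * ((k.factorial : ℝ) * (2 * q.2) ^ k /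
      (q.2 ^ 2 + 2 * q.2 * q.1 + 1) ^ (k + 1))) (Ioi 0 ×ˢ Icc 0 1) := by
  refine continuousOn_const.mul (ContinuousOn.div (by fun_prop) (by fun_prop) ?_)
  rintro ⟨u, x⟩ ⟨hu, hx⟩
  exact pow_ne_zero _ (zero_lt_one.trans_le (one_le_sq_add_two_mul_add_one hx.1 hu)).ne'

lemma integrableOn_arcoshQuotDeriv_integrand (k : ℕ) {u : ℝ} (hu : 0 < u) :
    IntegrableOn (fun x : ℝ => 2 * ((k.factorial : ℝ) * (2 * x) ^ k /
      (x ^ 2 + 2 * x * u + 1) ^ (k + 1))) (Icc 0 1) :=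
  ContinuousOn.integrableOn_Icc <| (continuousOn_arcoshQuotDeriv_integrand k).comp
    (f := fun x => (u, x)) (by fun_prop) fun _ hx => ⟨hu, hx⟩

lemma hasDerivAt_arcoshQuotDeriv (k : ℕ) {u : ℝ} (hu : 0 < u) :
    HasDerivAt (arcoshQuotDeriv k) (-arcoshQuotDeriv (k + 1) u) u := by
  rw [arcoshQuotDeriv, ← integral_neg]
  refine hasDerivAt_setIntegral_of_continuousOn (V := Ioi 0)
    (f := fun u x => 2 * ((k.factorial : ℝ) * (2 * x) ^ k / (x ^ 2 + 2 * x * u + 1) ^ (k + 1)))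
    (f' := fun u x => -(2 * (((k + 1).factorial : ℝ) * (2 * x) ^ (k + 1) /
      (x ^ 2 + 2 * x * u + 1) ^ (k + 1 + 1)))) isOpen_Ioi hu isCompact_Icc
    isCompact_Icc.measure_ne_top (continuousOn_arcoshQuotDeriv_integrand k)
    (continuousOn_arcoshQuotDeriv_integrand (k + 1)).neg
    fun s hs x hx => ?_
  have hne : x ^ 2 + 2 * x * s + 1 ≠ 0 :=
    (zero_lt_one.trans_le (one_le_sq_add_two_mul_add_one hx.1 hs)).ne'
  have hlin : HasDerivAt (fun s : ℝ => x ^ 2 + 2 * x * s + 1) (2 * x) s := by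
    simpa using (((hasDerivAt_id s).const_mul (2 * x)).const_add (x ^ 2)).add_const 1
  have h := (((hlin.pow (k + 1)).inv (pow_ne_zero _ hne)).const_mul
    ((k.factorial : ℝ) * (2 * x) ^ k)).const_mul 2
  simp only [div_eq_mul_inv]
  refine h.congr_deriv ?_
  rw [Nat.factorial_succ]
  simp only [Pi.pow_apply, Nat.add_sub_cancel]
  generalize x ^ 2 + 2 * x * s + 1 = D at hne
  push_cast
  field_simp
  ring

lemma continuousOn_arcoshQuotDeriv (k : ℕ) : ContinuousOn (arcoshQuotDeriv k) (Ioi 0) :=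
  fun _ hu => (hasDerivAt_arcoshQuotDeriv k hu).continuousAt.continuousWithinAt

lemma hasDerivAt_neg_one_pow_mul_arcoshQuotDeriv (k : ℕ) {u : ℝ} (hu : 0 < u) :
    HasDerivAt (fun u => (-1) ^ k * arcoshQuotDeriv k u)
      ((-1) ^ (k + 1) * arcoshQuotDeriv (k + 1) u) u :=
  ((hasDerivAt_arcoshQuotDeriv k hu).const_mul _).congr_deriv (by ring)

lemma iteratedDeriv_arcoshQuotDeriv_zero (k : ℕ) {u : ℝ} (hu : 0 < u) :
    iteratedDeriv k (arcoshQuotDeriv 0) u = (-1) ^ k * arcoshQuotDeriv k u := by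
  have h := eqOn_iteratedDeriv_of_forall_hasDerivAt (s := Ioi 0) isOpen_Ioi
    (fun k u hu => hasDerivAt_neg_one_pow_mul_arcoshQuotDeriv k hu) k hu
  simpa only [pow_zero, one_mul] using h

lemma contDiffOn_arcoshQuotDeriv_zero (n : ℕ) : ContDiffOn ℝ n (arcoshQuotDeriv 0) (Ioi 0) := by
  have h := contDiffOn_of_forall_hasDerivAt (s := Ioi 0) isOpen_Ioi
    (fun k u hu => hasDerivAt_neg_one_pow_mul_arcoshQuotDeriv k hu) n
  simpa only [pow_zero, one_mul] using h

lemma arcoshQuotDeriv_pos (k : ℕ) {u : ℝ} (hu : 0 < u) : 0 < arcoshQuotDeriv k u := by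
  rw [arcoshQuotDeriv, integral_Icc_eq_integral_Ioc,
    ← intervalIntegral.integral_of_le zero_le_one]
  refine intervalIntegral.intervalIntegral_pos_of_pos_on
    ((intervalIntegrable_iff_integrableOn_Icc_of_le zero_le_one).2
      (integrableOn_arcoshQuotDeriv_integrand k hu)) (fun x hx => ?_) one_pos
  have hx0 := hx.1
  positivity

lemma arcoshQuotDeriv_le (k : ℕ) {u : ℝ} (hu : 0 < u) :
    arcoshQuotDeriv k u ≤ 2 * (k.factorial * 2 ^ k) := by
  have h : arcoshQuotDeriv k u ≤ ∫ x in Icc (0 : ℝ) 1, 2 * ((k.factorial : ℝ) * 2 ^ k) := by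
    refine setIntegral_mono_on (integrableOn_arcoshQuotDeriv_integrand k hu)
      (integrableOn_const (by simp)) measurableSet_Icc fun x ⟨hx0, hx1⟩ => ?_
    have hD := one_le_sq_add_two_mul_add_one hx0 hu
    calc 2 * ((k.factorial : ℝ) * (2 * x) ^ k / (x ^ 2 + 2 * x * u + 1) ^ (k + 1))
        ≤ 2 * (k.factorial * (2 * x) ^ k) := by
          gcongr
          exact div_le_self (by positivity) (one_le_pow₀ hD)
      _ ≤ 2 * (k.factorial * 2 ^ k) := by gcongr; linarith
  simpa using h

/-- The primitive `(x² - 1) / (x² + 2xu + 1)` of the integrand takes the values `-1` and `0` at the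
end points `x = 0` and `x = 1`. -/
lemma mul_arcoshQuotDeriv_zero_sub {u : ℝ} (hu : 0 < u) :
    u * arcoshQuotDeriv 0 u - (u ^ 2 - 1) * arcoshQuotDeriv 1 u = 1 := by
  have hint k := integrableOn_arcoshQuotDeriv_integrand k hu
  rw [arcoshQuotDeriv, arcoshQuotDeriv, ← integral_const_mul, ← integral_const_mul,
    ← integral_sub ((hint 0).const_mul _) ((hint 1).const_mul _), integral_Icc_eq_integral_Ioc,
    ← intervalIntegral.integral_of_le zero_le_one]
  refine (intervalIntegral.integral_eq_sub_of_hasDerivAt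
    (f := fun x => (x ^ 2 - 1) / (x ^ 2 + 2 * x * u + 1)) (fun x hx => ?_)
    ((intervalIntegrable_iff_integrableOn_Icc_of_le zero_le_one).2
      (((hint 0).const_mul _).sub ((hint 1).const_mul _)))).trans (by norm_num)
  rw [uIcc_of_le zero_le_one] at hx
  have hne : x ^ 2 + 2 * x * u + 1 ≠ 0 :=
    (zero_lt_one.trans_le (one_le_sq_add_two_mul_add_one hx.1 hu)).ne'
  have hnum : HasDerivAt (fun x : ℝ => x ^ 2 - 1) (2 * x) x := by
    simpa using (hasDerivAt_pow 2 x).sub_const 1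
  have hden : HasDerivAt (fun x : ℝ => x ^ 2 + 2 * x * u + 1) (2 * x + 2 * u) x := by
    simpa using ((hasDerivAt_pow 2 x).add
      (((hasDerivAt_id x).const_mul 2).mul_const u)).add_const (1 : ℝ)
  refine (hnum.div hden hne).congr_deriv ?_
  simp only [Pi.sub_apply, Nat.factorial]
  push_cast
  field_simp
  ring

/-- The smooth extension of `arcosh²` to `(0, ∞)`. -/
def arcoshSq (u : ℝ) : ℝ := (u ^ 2 - 1) * arcoshQuotDeriv 0 u ^ 2

lemma hasDerivAt_arcoshSq {u : ℝ} (hu : 0 < u) :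
    HasDerivAt arcoshSq (2 * arcoshQuotDeriv 0 u) u := by
  have hsq : HasDerivAt (fun x : ℝ => x ^ 2 - 1) (2 * u) u := by
    simpa using (hasDerivAt_pow 2 u).sub_const 1
  refine (hsq.mul ((hasDerivAt_arcoshQuotDeriv 0 hu).pow 2)).congr_deriv ?_
  simp only [zero_add, Pi.pow_apply]
  linear_combination 2 * arcoshQuotDeriv 0 u * mul_arcoshQuotDeriv_zero_sub hu

lemma arcoshQuotDeriv_zero_cosh_mul_sinh (ρ : ℝ) :
    arcoshQuotDeriv 0 (Real.cosh ρ) * Real.sinh ρ = ρ := by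
  have hderiv (r : ℝ) : HasDerivAt
      (fun r => arcoshQuotDeriv 0 (Real.cosh r) * Real.sinh r - r) 0 r := by
    refine ((((hasDerivAt_arcoshQuotDeriv 0 (Real.cosh_pos r)).comp r
      (Real.hasDerivAt_cosh r)).mul (Real.hasDerivAt_sinh r)).sub (hasDerivAt_id r)).congr_deriv ?_
    simp only [zero_add, Function.comp]
    linear_combination mul_arcoshQuotDeriv_zero_sub (Real.cosh_pos r) +
      arcoshQuotDeriv 1 (Real.cosh r) * Real.cosh_sq r
  have hconst := is_const_of_deriv_eq_zero (fun r => (hderiv r).differentiableAt)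
    (fun r => (hderiv r).deriv) ρ 0
  simpa [sub_eq_zero] using hconst

lemma arcoshSq_cosh (ρ : ℝ) : arcoshSq (Real.cosh ρ) = ρ ^ 2 := by
  rw [arcoshSq, Real.cosh_sq, add_sub_cancel_right, ← mul_pow, mul_comm,
    arcoshQuotDeriv_zero_cosh_mul_sinh]

lemma log_sq_le_arcoshSq {u : ℝ} (hu : 1 ≤ u) : Real.log u ^ 2 ≤ arcoshSq u := by
  obtain ⟨ρ, hρ, rfl⟩ : ∃ ρ, 0 ≤ ρ ∧ Real.cosh ρ = u :=
    ⟨Real.arcosh u, Real.arcosh_nonneg hu, Real.cosh_arcosh hu⟩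
  rw [arcoshSq_cosh]
  refine pow_le_pow_left₀ (Real.log_nonneg hu) ?_ 2
  rw [Real.log_le_iff_le_exp (Real.cosh_pos ρ), ← Real.cosh_add_sinh]
  linarith [Real.sinh_nonneg_iff.2 hρ]

lemma neg_four_le_arcoshSq {u : ℝ} (hu : 0 < u) : -4 ≤ arcoshSq u := by
  have hle : arcoshQuotDeriv 0 u ≤ 2 := by simpa using arcoshQuotDeriv_le 0 hu
  have hsq : arcoshQuotDeriv 0 u ^ 2 ≤ 2 ^ 2 :=
    pow_le_pow_left₀ (arcoshQuotDeriv_pos 0 hu).le hle 2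
  rw [arcoshSq]
  nlinarith [mul_nonneg (sq_nonneg u) (sq_nonneg (arcoshQuotDeriv 0 u))]

/-! ### The heat kernel of the line and its derivatives -/

lemma contDiffOn_arcoshSq (n : ℕ) : ContDiffOn ℝ n arcoshSq (Ioi 0) :=
  ((contDiff_id.pow 2).sub contDiff_const).contDiffOn.mul
    ((contDiffOn_arcoshQuotDeriv_zero n).pow 2)

lemma continuousOn_arcoshSq : ContinuousOn arcoshSq (Ioi 0) := (contDiffOn_arcoshSq 0).continuousOn

/-- The heat kernel `(4πt)^(-1/2) exp(-ρ²/4t)` of the line as a function of `u = cosh ρ`, extended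
smoothly to all `u > 0`. -/
def lineKernel (u t : ℝ) : ℝ := (√(4 * Real.pi * t))⁻¹ * Real.exp (-arcoshSq u / (4 * t))

lemma lineKernel_pos {u t : ℝ} (ht : 0 < t) : 0 < lineKernel u t := by
  have := Real.pi_pos
  rw [lineKernel]
  positivity

lemma contDiffOn_lineKernel (n : ℕ) (t : ℝ) : ContDiffOn ℝ n (lineKernel · t) (Ioi 0) :=
  contDiffOn_const.mul ((contDiffOn_arcoshSq n).neg.div_const _).exp

lemma continuousOn_lineKernel : ContinuousOn ↿lineKernel (Ioi 0 ×ˢ Ioi 0) := by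
  refine ContinuousOn.mul (ContinuousOn.inv₀ (by fun_prop) ?_) (ContinuousOn.rexp
    (ContinuousOn.div (continuousOn_arcoshSq.comp continuousOn_fst fun _ hq => hq.1).neg
      (by fun_prop) ?_))
  · rintro ⟨u, t⟩ ⟨-, ht : 0 < t⟩
    have := Real.pi_pos
    positivity
  · rintro ⟨u, t⟩ ⟨-, ht : 0 < t⟩
    positivity

lemma hasDerivAt_lineKernel {u : ℝ} (hu : 0 < u) (t : ℝ) :
    HasDerivAt (lineKernel · t) (-(2 * t)⁻¹ * (arcoshQuotDeriv 0 u * lineKernel u t)) u := by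
  refine ((((hasDerivAt_arcoshSq hu).neg.div_const (4 * t)).exp).const_mul _).congr_deriv ?_
  rw [lineKernel, Pi.neg_apply]
  ring

lemma lineKernel_cosh (ρ t : ℝ) :
    lineKernel (Real.cosh ρ) t = (√(4 * Real.pi * t))⁻¹ * Real.exp (-ρ ^ 2 / (4 * t)) := by
  rw [lineKernel, arcoshSq_cosh]

/-- `(-∂ᵤ)^m` applied to the heat kernel of the line. Up to the factor
`(2π)^(-m) exp(-m²t)`, this is the heat kernel of hyperbolic space of dimension `2m + 1`. -/
def lineKernelDeriv (m : ℕ) (u t : ℝ) : ℝ := (-1) ^ m * iteratedDeriv m (lineKernel · t) u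

lemma lineKernelDeriv_zero : lineKernelDeriv 0 = lineKernel := by
  ext u t
  simp [lineKernelDeriv]

/-- Leibniz' rule for the product in
`∂ᵤ lineKernel = -(2t)⁻¹ * (arcosh u / √(u² - 1)) * lineKernel`.
-/
lemma lineKernelDeriv_succ (m : ℕ) {u : ℝ} (hu : 0 < u) (t : ℝ) :
    lineKernelDeriv (m + 1) u t = (2 * t)⁻¹ * ∑ i ∈ Finset.range (m + 1),
      m.choose i * (arcoshQuotDeriv i u * lineKernelDeriv (m - i) u t) := by
  have hderiv : deriv (lineKernel · t) =ᶠ[𝓝 u]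
      fun v => -(2 * t)⁻¹ * (arcoshQuotDeriv 0 v * lineKernel v t) := by
    filter_upwards [Ioi_mem_nhds hu] with v hv using (hasDerivAt_lineKernel hv t).deriv
  have hsmooth {f : ℝ → ℝ} (hf : ContDiffOn ℝ m f (Ioi 0)) : ContDiffAt ℝ m f u :=
    hf.contDiffAt (Ioi_mem_nhds hu)
  rw [lineKernelDeriv, iteratedDeriv_succ', hderiv.iteratedDeriv_eq, iteratedDeriv_const_mul_field,
    iteratedDeriv_fun_mul (hsmooth (contDiffOn_arcoshQuotDeriv_zero m))
      (hsmooth (contDiffOn_lineKernel m t)), ← mul_assoc, Finset.mul_sum, Finset.mul_sum]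
  refine Finset.sum_congr rfl fun i hi => ?_
  obtain ⟨j, rfl⟩ := Nat.exists_eq_add_of_le (Nat.lt_succ_iff.1 (Finset.mem_range.1 hi))
  have hsign : ((-1 : ℝ) ^ i) ^ 2 = 1 := by rw [← pow_mul, mul_comm, pow_mul]; simp
  rw [iteratedDeriv_arcoshQuotDeriv_zero i hu, Nat.add_sub_cancel_left, lineKernelDeriv]
  linear_combination ((-1) ^ j * (2 * t)⁻¹ * (i + j).choose i * arcoshQuotDeriv i u *
    iteratedDeriv j (lineKernel · t) u) * hsign

lemma lineKernelDeriv_one {u : ℝ} (hu : 0 < u) (t : ℝ) :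
    lineKernelDeriv 1 u t = (2 * t)⁻¹ * (arcoshQuotDeriv 0 u * lineKernel u t) := by
  simp [lineKernelDeriv_succ 0 hu, lineKernelDeriv_zero]

lemma lineKernelDeriv_two {u : ℝ} (hu : 0 < u) (t : ℝ) :
    lineKernelDeriv 2 u t = (2 * t)⁻¹ * (arcoshQuotDeriv 0 u * lineKernelDeriv 1 u t +
      arcoshQuotDeriv 1 u * lineKernel u t) := by
  simp [lineKernelDeriv_succ 1 hu, lineKernelDeriv_zero, Finset.sum_range_succ]

/-- The line kernel is completely monotone in `u = cosh ρ`, because `arcosh u / √(u² - 1)` is. -/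
lemma lineKernelDeriv_pos (m : ℕ) {u t : ℝ} (hu : 0 < u) (ht : 0 < t) :
    0 < lineKernelDeriv m u t := by
  induction m using Nat.strong_induction_on with
  | _ m ih =>
    cases m with
    | zero => exact lineKernelDeriv_zero ▸ lineKernel_pos ht
    | succ m =>
      rw [lineKernelDeriv_succ m hu]
      refine mul_pos (by positivity) (Finset.sum_pos (fun i hi => ?_) (by simp))
      rw [Finset.mem_range] at hi
      exact mul_pos (by exact_mod_cast Nat.choose_pos (by omega))
        (mul_pos (arcoshQuotDeriv_pos _ hu) (ih _ (by omega)))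

lemma hasDerivAt_lineKernelDeriv (m : ℕ) {u : ℝ} (hu : 0 < u) (t : ℝ) :
    HasDerivAt (lineKernelDeriv m · t) (-lineKernelDeriv (m + 1) u t) u := by
  have hdiff : DifferentiableAt ℝ (iteratedDeriv m (lineKernel · t)) u :=
    (((contDiffOn_lineKernel (m + 1) t).differentiableOn_iteratedDerivWithin (by norm_cast; omega)
      (uniqueDiffOn_Ioi 0)).congr fun v hv => (iteratedDerivWithin_of_isOpen isOpen_Ioi hv).symm)
      |>.differentiableAt (Ioi_mem_nhds hu)
  refine (hdiff.hasDerivAt.const_mul ((-1) ^ m)).congr_deriv ?_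
  rw [lineKernelDeriv, iteratedDeriv_succ]
  ring

lemma continuousOn_lineKernelDeriv (m : ℕ) :
    ContinuousOn ↿(lineKernelDeriv m) (Ioi 0 ×ˢ Ioi 0) := by
  induction m using Nat.strong_induction_on with
  | _ m ih =>
    cases m with
    | zero => exact lineKernelDeriv_zero ▸ continuousOn_lineKernel
    | succ m =>
      refine ContinuousOn.congr ?_ fun q hq => lineKernelDeriv_succ m hq.1 q.2
      refine ContinuousOn.mul (ContinuousOn.inv₀ (by fun_prop) fun q hq => ?_)
        (continuousOn_finsetSum _ fun i _ => continuousOn_const.mul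
          (((continuousOn_arcoshQuotDeriv i).comp continuousOn_fst fun _ hq => hq.1).mul
            (ih (m - i) (by omega))))
      have : 0 < q.2 := hq.2
      positivity

lemma hasDerivAt_lineKernel_time {u t : ℝ} (hu : 0 < u) (ht : 0 < t) :
    HasDerivAt (lineKernel u)
      ((u ^ 2 - 1) * lineKernelDeriv 2 u t - u * lineKernelDeriv 1 u t) t := by
  have hpos : 0 < 4 * Real.pi * t := by have := Real.pi_pos; positivity
  have hlin (c : ℝ) : HasDerivAt (fun t => c * t) c t := by
    simpa using (hasDerivAt_id t).const_mul c
  have hsqrt := ((hlin (4 * Real.pi)).sqrt hpos.ne').inv (Real.sqrt_pos.2 hpos).ne'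
  have hexponent : HasDerivAt (fun t => -arcoshSq u / (4 * t)) (arcoshSq u / (4 * t ^ 2)) t := by
    refine ((hasDerivAt_const t (-arcoshSq u)).div (hlin 4) (by positivity)).congr_deriv ?_
    field_simp
    simp
  have hlogDeriv : HasDerivAt (lineKernel u)
      (lineKernel u t * (-(2 * t)⁻¹ + arcoshSq u / (4 * t ^ 2))) t := by
    refine (hsqrt.mul hexponent.exp).congr_deriv ?_
    have hs0 := (Real.sqrt_pos.2 hpos).ne'
    rw [lineKernel, Pi.inv_apply, Real.sq_sqrt hpos.le]
    field_simp
  refine hlogDeriv.congr_deriv ?_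
  rw [lineKernelDeriv_two hu, lineKernelDeriv_one hu, arcoshSq]
  field_simp
  linear_combination 8 * t * lineKernel u t * mul_arcoshQuotDeriv_zero_sub hu

/-- The right-hand side of the heat equation `∂ₜ F₀ = (u² - 1) F₂ - (2m + 1) u F₁ + m² F₀` solved by
the `m`-th derivative `F₀` of the line kernel, where `F₁ = -∂ᵤ F₀` and `F₂ = ∂ᵤ² F₀`. Up to the
zeroth-order term, this is the radial Laplacian in dimension `2m + 1` in the variable
`u = cosh ρ`. -/
def radialHeatOp (m : ℝ) (F₀ F₁ F₂ : ℝ → ℝ) (u : ℝ) : ℝ :=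
  (u ^ 2 - 1) * F₂ u - (2 * m + 1) * u * F₁ u + m ^ 2 * F₀ u

lemma hasDerivAt_radialHeatOp (m : ℝ) {F₀ F₁ F₂ F₃ : ℝ → ℝ} {u : ℝ}
    (h₀ : HasDerivAt F₀ (-F₁ u) u) (h₁ : HasDerivAt F₁ (-F₂ u) u) (h₂ : HasDerivAt F₂ (-F₃ u) u) :
    HasDerivAt (radialHeatOp m F₀ F₁ F₂) (-radialHeatOp (m + 1) F₁ F₂ F₃ u) u := by
  have hsq : HasDerivAt (fun x : ℝ => x ^ 2 - 1) (2 * u) u := by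
    simpa using (hasDerivAt_pow 2 u).sub_const 1
  have hlin : HasDerivAt (fun x : ℝ => (2 * m + 1) * x) (2 * m + 1) u := by
    simpa using (hasDerivAt_id u).const_mul (2 * m + 1)
  refine (((hsq.mul h₂).sub (hlin.mul h₁)).add (h₀.const_mul (m ^ 2))).congr_deriv ?_
  rw [radialHeatOp]
  ring

lemma continuousOn_radialHeatOp (m : ℝ) {F₀ F₁ F₂ : ℝ → ℝ → ℝ} {s : Set (ℝ × ℝ)}
    (h₀ : ContinuousOn ↿F₀ s) (h₁ : ContinuousOn ↿F₁ s) (h₂ : ContinuousOn ↿F₂ s) :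
    ContinuousOn ↿(fun u t => radialHeatOp m (F₀ · t) (F₁ · t) (F₂ · t) u) s :=
  (((by fun_prop : ContinuousOn (fun q : ℝ × ℝ => q.1 ^ 2 - 1) s).mul h₂).sub
    ((by fun_prop : ContinuousOn (fun q : ℝ × ℝ => (2 * m + 1) * q.1) s).mul h₁)).add
    (continuousOn_const.mul h₀)

lemma hasDerivAt_lineKernelDeriv_time (m : ℕ) {u t : ℝ} (hu : 0 < u) (ht : 0 < t) :
    HasDerivAt (lineKernelDeriv m u) (radialHeatOp m (lineKernelDeriv m · t)
      (lineKernelDeriv (m + 1) · t) (lineKernelDeriv (m + 2) · t) u) t := by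
  have hcont (m : ℕ) := continuousOn_radialHeatOp m (continuousOn_lineKernelDeriv m)
    (continuousOn_lineKernelDeriv (m + 1)) (continuousOn_lineKernelDeriv (m + 2))
  induction m generalizing u t with
  | zero => simpa [radialHeatOp, lineKernelDeriv_zero] using hasDerivAt_lineKernel_time hu ht
  | succ m ih =>
    have hop (u : ℝ) (hu : 0 < u) (t : ℝ) := hasDerivAt_radialHeatOp m
      (F₃ := (lineKernelDeriv (m + 3) · t)) (hasDerivAt_lineKernelDeriv m hu t)
      (hasDerivAt_lineKernelDeriv (m + 1) hu t) (hasDerivAt_lineKernelDeriv (m + 2) hu t)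
    rw [← Nat.cast_add_one] at hop
    have hcomm := (hasDerivAt_partial_comm (g := fun u t => -lineKernelDeriv (m + 1) u t)
      isOpen_Ioi isOpen_Ioi (fun u hu t _ => hasDerivAt_lineKernelDeriv m hu t)
      (fun u hu t ht => ih hu ht) (fun u hu t _ => hop u hu t) (hcont m)
      (hcont (m + 1)).neg hu ht).neg
    rw [neg_neg] at hcomm
    exact hcomm.congr_of_eventuallyEq (Eventually.of_forall fun t => (neg_neg _).symm)

/-! ### Rapid decay and the Abel transform -/

/-- `F u t = O((1 + u)^(-N))`, uniformly in `u > 0` and locally uniformly in `t > 0`. -/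
def HasDecay (N : ℕ) (F : ℝ → ℝ → ℝ) : Prop :=
  ∀ t₁ t₂ : ℝ, 0 < t₁ → ∃ C, 0 ≤ C ∧
    ∀ u t, 0 < u → t₁ ≤ t → t ≤ t₂ → |F u t| ≤ C / (1 + u) ^ N

namespace HasDecay

variable {M N : ℕ} {F G : ℝ → ℝ → ℝ}

lemma mono (hF : HasDecay N F) (hMN : M ≤ N) : HasDecay M F := by
  intro t₁ t₂ h₁
  obtain ⟨C, hC0, hC⟩ := hF t₁ t₂ h₁
  refine ⟨C, hC0, fun u t hu ht₁ ht₂ => (hC u t hu ht₁ ht₂).trans ?_⟩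
  gcongr
  linarith

lemma add (hF : HasDecay N F) (hG : HasDecay N G) : HasDecay N fun u t => F u t + G u t := by
  intro t₁ t₂ h₁
  obtain ⟨C, hC0, hC⟩ := hF t₁ t₂ h₁
  obtain ⟨D, hD0, hD⟩ := hG t₁ t₂ h₁
  refine ⟨C + D, by positivity, fun u t hu ht₁ ht₂ => ?_⟩
  rw [add_div]
  exact (abs_add_le _ _).trans (add_le_add (hC u t hu ht₁ ht₂) (hD u t hu ht₁ ht₂))

lemma mul (hF : HasDecay M F) (hG : HasDecay N G) :
    HasDecay (M + N) fun u t => F u t * G u t := by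
  intro t₁ t₂ h₁
  obtain ⟨C, hC0, hC⟩ := hF t₁ t₂ h₁
  obtain ⟨D, hD0, hD⟩ := hG t₁ t₂ h₁
  refine ⟨C * D, by positivity, fun u t hu ht₁ ht₂ => ?_⟩
  rw [abs_mul, pow_add, mul_div_mul_comm]
  exact mul_le_mul (hC u t hu ht₁ ht₂) (hD u t hu ht₁ ht₂) (abs_nonneg _) (by positivity)

lemma const (c : ℝ) : HasDecay 0 fun _ _ => c :=
  fun _ _ _ => ⟨|c|, abs_nonneg c, fun _ _ _ _ _ => by simp⟩

lemma const_mul (hF : HasDecay N F) (c : ℝ) : HasDecay N fun u t => c * F u t := by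
  simpa using (const c).mul hF

lemma sum {ι : Type*} {s : Finset ι} {F : ι → ℝ → ℝ → ℝ} (hF : ∀ i ∈ s, HasDecay N (F i)) :
    HasDecay N fun u t => ∑ i ∈ s, F i u t := by
  induction s using Finset.cons_induction with
  | empty => exact fun _ _ _ => ⟨0, le_rfl, fun _ _ _ _ _ => by simp⟩
  | cons i s hi ih =>
    simp only [Finset.sum_cons]
    exact (hF i (by simp)).add (ih fun j hj => hF j (by simp [hj]))

lemma id_mul (hF : HasDecay (N + 1) F) : HasDecay N fun u t => u * F u t := by
  intro t₁ t₂ h₁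
  obtain ⟨C, hC0, hC⟩ := hF t₁ t₂ h₁
  refine ⟨C, hC0, fun u t hu ht₁ ht₂ => ?_⟩
  rw [abs_mul, abs_of_pos hu]
  calc u * |F u t| ≤ (1 + u) * (C / (1 + u) ^ (N + 1)) := by
        gcongr
        · linarith
        · exact hC u t hu ht₁ ht₂
    _ = C / (1 + u) ^ N := by
        rw [pow_succ]
        field_simp

lemma radialHeatOp {F₀ F₁ F₂ : ℝ → ℝ → ℝ} (m : ℝ) (h₀ : HasDecay N F₀) (h₁ : HasDecay (N + 1) F₁)
    (h₂ : HasDecay (N + 2) F₂) :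
    HasDecay N fun u t => radialHeatOp m (F₀ · t) (F₁ · t) (F₂ · t) u := by
  have h := (h₂.id_mul.id_mul.add ((h₂.mono (by omega)).const_mul (-1))).add
    ((h₁.id_mul.const_mul (-(2 * m + 1))).add (h₀.const_mul (m ^ 2)))
  convert! h using 3
  rw [HypHeat.radialHeatOp]
  ring

lemma congr (hF : HasDecay N F) (h : ∀ u t, 0 < u → 0 < t → G u t = F u t) : HasDecay N G := by
  intro t₁ t₂ h₁
  obtain ⟨C, hC0, hC⟩ := hF t₁ t₂ h₁
  exact ⟨C, hC0, fun u t hu ht₁ ht₂ => h u t hu (h₁.trans_le ht₁) ▸ hC u t hu ht₁ ht₂⟩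

/-- In the variable `u + w²/2`, decay may be traded between `u` and `w`. -/
lemma abs_comp_add_half_sq_le (hF : HasDecay (M + N) F) {t₁ : ℝ} (t₂ : ℝ) (h₁ : 0 < t₁) :
    ∃ C, 0 ≤ C ∧ ∀ u t w, 0 < u → t₁ ≤ t → t ≤ t₂ →
      |F (u + w ^ 2 / 2) t| ≤ C / (1 + u) ^ M * (1 + w ^ 2)⁻¹ ^ N := by
  obtain ⟨C, hC0, hC⟩ := hF t₁ t₂ h₁
  refine ⟨C * 2 ^ N, by positivity, fun u t w hu ht₁ ht₂ => ?_⟩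
  have hw : (1 + (u + w ^ 2 / 2))⁻¹ ≤ 2 * (1 + w ^ 2)⁻¹ := by
    rw [← div_eq_mul_inv, ← one_div, div_le_div_iff₀ (by positivity) (by positivity)]
    nlinarith
  have hu' : (1 + (u + w ^ 2 / 2))⁻¹ ≤ (1 + u)⁻¹ := by
    gcongr
    linarith [sq_nonneg w]
  calc |F (u + w ^ 2 / 2) t|
      ≤ C / (1 + (u + w ^ 2 / 2)) ^ (M + N) := hC _ t (by positivity) ht₁ ht₂
    _ = C * ((1 + (u + w ^ 2 / 2))⁻¹ ^ M * (1 + (u + w ^ 2 / 2))⁻¹ ^ N) := by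
        rw [← pow_add, inv_pow, div_eq_mul_inv]
    _ ≤ C * ((1 + u)⁻¹ ^ M * (2 * (1 + w ^ 2)⁻¹) ^ N) := by gcongr
    _ = C * 2 ^ N / (1 + u) ^ M * (1 + w ^ 2)⁻¹ ^ N := by
        rw [mul_pow, inv_pow, div_eq_mul_inv]
        ring

lemma tendsto_atTop (hF : HasDecay 1 F) {t : ℝ} (ht : 0 < t) :
    Tendsto (F · t) atTop (𝓝 0) := by
  obtain ⟨C, -, hC⟩ := hF t t ht
  refine squeeze_zero_norm' (a := fun u => C / (1 + u)) ?_
    (tendsto_const_nhds.div_atTop (tendsto_atTop_add_const_left _ _ tendsto_id))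
  filter_upwards [eventually_gt_atTop 0] with u hu
  simpa using hC u t hu le_rfl le_rfl

end HasDecay

section LineKernel

lemma exp_neg_arcoshSq_div_mul_pow_le (N : ℕ) {t₁ t₂ u t : ℝ} (h₁ : 0 < t₁) (ht₁ : t₁ ≤ t)
    (ht₂ : t ≤ t₂) (hu : 0 < u) :
    Real.exp (-arcoshSq u / (4 * t)) * (1 + u) ^ N ≤
      (Real.exp (t₂ * N ^ 2) + Real.exp t₁⁻¹) * 2 ^ N := by
  have ht : 0 < t := h₁.trans_le ht₁
  rcases le_or_gt 1 u with h | h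
  · have hlog : -arcoshSq u / (4 * t) ≤ t₂ * N ^ 2 - N * Real.log u := by
      rw [div_le_iff₀ (by positivity)]
      nlinarith [log_sq_le_arcoshSq h, sq_nonneg (Real.log u - 2 * t * N),
        mul_nonneg (mul_nonneg (sub_nonneg.2 ht₂) (sq_nonneg (N : ℝ))) ht.le]
    have hpow : Real.exp (N * Real.log u) = u ^ N := by rw [Real.exp_nat_mul, Real.exp_log hu]
    calc Real.exp (-arcoshSq u / (4 * t)) * (1 + u) ^ N
        ≤ Real.exp (t₂ * N ^ 2 - N * Real.log u) * (2 * u) ^ N := by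
          gcongr
          linarith
      _ = Real.exp (t₂ * N ^ 2) * 2 ^ N := by
          rw [Real.exp_sub, hpow, mul_pow]
          field_simp
      _ ≤ _ := by gcongr; linarith [Real.exp_pos t₁⁻¹]
  · have hexp : -arcoshSq u / (4 * t) ≤ t₁⁻¹ := by
      rw [div_le_iff₀ (by positivity)]
      have : 1 ≤ t₁⁻¹ * t := by rwa [inv_mul_eq_div, one_le_div h₁]
      nlinarith [neg_four_le_arcoshSq hu]
    gcongr
    · linarith [Real.exp_le_exp.2 hexp, Real.exp_pos (t₂ * N ^ 2)]
    · linarith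

lemma hasDecay_lineKernel (N : ℕ) : HasDecay N lineKernel := by
  intro t₁ t₂ h₁
  have := Real.pi_pos
  refine ⟨(√(4 * Real.pi * t₁))⁻¹ * ((Real.exp (t₂ * N ^ 2) + Real.exp t₁⁻¹) * 2 ^ N),
    by positivity, fun u t hu ht₁ ht₂ => ?_⟩
  rw [abs_of_pos (lineKernel_pos (h₁.trans_le ht₁)), le_div_iff₀ (by positivity), lineKernel,
    mul_assoc]
  exact mul_le_mul (by gcongr) (exp_neg_arcoshSq_div_mul_pow_le N h₁ ht₁ ht₂ hu) (by positivity)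
    (by positivity)

lemma hasDecay_lineKernelDeriv (m N : ℕ) : HasDecay N (lineKernelDeriv m) := by
  induction m using Nat.strong_induction_on with
  | _ m ih =>
    cases m with
    | zero => exact lineKernelDeriv_zero ▸ hasDecay_lineKernel N
    | succ m =>
      have hquot (i : ℕ) : HasDecay 0 fun u _ => arcoshQuotDeriv i u := fun _ _ _ =>
        ⟨2 * (i.factorial * 2 ^ i), by positivity, fun u _ hu _ _ => by
          simpa [abs_of_pos (arcoshQuotDeriv_pos i hu)] using arcoshQuotDeriv_le i hu⟩
      have hinv : HasDecay 0 fun _ t => (2 * t)⁻¹ := fun t₁ _ h₁ =>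
        ⟨(2 * t₁)⁻¹, by positivity, fun _ t _ ht₁ _ => by
          have := h₁.trans_le ht₁
          rw [abs_of_pos (by positivity), pow_zero, div_one]
          exact inv_anti₀ (by positivity) (by linarith)⟩
      refine .congr ?_ fun u t hu _ => lineKernelDeriv_succ m hu t
      simpa using hinv.mul (.sum (N := N) fun i _ => by
        simpa using ((hquot i).mul (ih (m - i) (by omega))).const_mul (m.choose i))

end LineKernel

/-- The Abel transform. In the variable `u = cosh ρ`, it integrates a radial function on hyperbolic
space of dimension `d + 1` over horocycles to obtain one on hyperbolic space of dimension `d`. -/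
def abelTransform (f : ℝ → ℝ) (u : ℝ) : ℝ := ∫ w : ℝ, f (u + w ^ 2 / 2)

lemma hasDerivAt_comp_add_half_sq {f : ℝ → ℝ} {f' u w : ℝ} (hf : HasDerivAt f f' (u + w ^ 2 / 2)) :
    HasDerivAt (fun w => f (u + w ^ 2 / 2)) (w * f') w := by
  have hsq : HasDerivAt (fun w : ℝ => u + w ^ 2 / 2) w w := by
    simpa using ((hasDerivAt_pow 2 w).div_const 2).const_add u
  exact (hf.comp w hsq).congr_deriv (mul_comm _ _)

section AbelTransform

variable {F F' : ℝ → ℝ → ℝ} {u t : ℝ}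

lemma continuous_comp_add_half_sq (hF : ContinuousOn ↿F (Ioi 0 ×ˢ Ioi 0)) (hu : 0 < u)
    (ht : 0 < t) : Continuous fun w : ℝ => F (u + w ^ 2 / 2) t :=
  hF.comp_continuous (f := fun w : ℝ => (u + w ^ 2 / 2, t)) (by fun_prop)
    fun w => ⟨by simp only [mem_Ioi]; positivity, ht⟩

lemma integrable_pow_mul_comp_add_half_sq {k : ℕ} (hF : ContinuousOn ↿F (Ioi 0 ×ˢ Ioi 0))
    (hdecay : HasDecay (k + 1) F) (hu : 0 < u) (ht : 0 < t) :
    Integrable fun w : ℝ => w ^ k * F (u + w ^ 2 / 2) t := by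
  obtain ⟨C, _, hC⟩ := HasDecay.abs_comp_add_half_sq_le (M := 0) (N := k + 1)
    (by simpa using hdecay) t ht
  refine (integrable_inv_one_add_sq.const_mul C).mono' (((continuous_id.pow k).mul
    (continuous_comp_add_half_sq hF hu ht)).aestronglyMeasurable) (ae_of_all _ fun w => ?_)
  have hw : |w| ≤ 1 + w ^ 2 := by
    rw [abs_le]
    constructor <;> nlinarith [sq_nonneg (w + 1), sq_nonneg (w - 1)]
  calc ‖w ^ k * F (u + w ^ 2 / 2) t‖ = |w| ^ k * |F (u + w ^ 2 / 2) t| := by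
        rw [norm_mul, norm_pow, Real.norm_eq_abs, Real.norm_eq_abs]
    _ ≤ (1 + w ^ 2) ^ k * (C * (1 + w ^ 2)⁻¹ ^ (k + 1)) := by
        gcongr
        simpa using hC u t w hu le_rfl le_rfl
    _ = C * (1 + w ^ 2)⁻¹ := by
        rw [inv_pow]
        field_simp
        ring

lemma integrable_comp_add_half_sq (hF : ContinuousOn ↿F (Ioi 0 ×ˢ Ioi 0)) (hdecay : HasDecay 1 F)
    (hu : 0 < u) (ht : 0 < t) : Integrable fun w : ℝ => F (u + w ^ 2 / 2) t := by
  simpa using integrable_pow_mul_comp_add_half_sq (k := 0) hF hdecay hu ht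

lemma ofReal_abelTransform (hF : ContinuousOn ↿F (Ioi 0 ×ˢ Ioi 0)) (hdecay : HasDecay 1 F)
    (hpos : ∀ v, 0 < v → 0 ≤ F v t) (hu : 0 < u) (ht : 0 < t) :
    ENNReal.ofReal (abelTransform (F · t) u) =
      ∫⁻ w : ℝ, ENNReal.ofReal (F (u + w ^ 2 / 2) t) :=
  ofReal_integral_eq_lintegral_ofReal (integrable_comp_add_half_sq hF hdecay hu ht)
    (ae_of_all _ fun w => hpos _ (by positivity))

lemma abelTransform_pos (hF : ContinuousOn ↿F (Ioi 0 ×ˢ Ioi 0)) (hdecay : HasDecay 1 F)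
    (hpos : ∀ v, 0 < v → 0 < F v t) (hu : 0 < u) (ht : 0 < t) : 0 < abelTransform (F · t) u := by
  have hpos' (w : ℝ) : 0 < F (u + w ^ 2 / 2) t := hpos _ (by positivity)
  have hsupp : Function.support (fun w : ℝ => F (u + w ^ 2 / 2) t) = univ :=
    eq_univ_of_forall fun w => (hpos' w).ne'
  rw [abelTransform, integral_pos_iff_support_of_nonneg (fun w => (hpos' w).le)
    (integrable_comp_add_half_sq hF hdecay hu ht), hsupp]
  simp

lemma hasDerivAt_abelTransform (hF : ContinuousOn ↿F (Ioi 0 ×ˢ Ioi 0)) (hdecay : HasDecay 1 F)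
    (hF' : ContinuousOn ↿F' (Ioi 0 ×ˢ Ioi 0)) (hdecay' : HasDecay 1 F')
    (hderiv : ∀ v, 0 < v → HasDerivAt (F · t) (F' v t) v) (hu : 0 < u) (ht : 0 < t) :
    HasDerivAt (abelTransform (F · t)) (abelTransform (F' · t) u) u := by
  obtain ⟨C, _, hC⟩ := hdecay'.abs_comp_add_half_sq_le (M := 0) (N := 1) t ht
  refine (hasDerivAt_integral_of_dominated_loc_of_deriv_le
    (F := fun u w => F (u + w ^ 2 / 2) t) (F' := fun u w => F' (u + w ^ 2 / 2) t)
    (bound := fun w => C * (1 + w ^ 2)⁻¹) (Ioi_mem_nhds hu) ?_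
    (integrable_comp_add_half_sq hF hdecay hu ht)
    (continuous_comp_add_half_sq hF' hu ht).aestronglyMeasurable ?_
    (integrable_inv_one_add_sq.const_mul C) ?_).2
  · filter_upwards [Ioi_mem_nhds hu] with v hv
      using (continuous_comp_add_half_sq hF hv ht).aestronglyMeasurable
  · exact ae_of_all _ fun w v hv => by simpa using hC v t w hv le_rfl le_rfl
  · exact ae_of_all _ fun w v (hv : 0 < v) =>
      (hderiv (v + w ^ 2 / 2) (by positivity)).comp_add_const v (w ^ 2 / 2)

lemma hasDerivAt_abelTransform_time (hF : ContinuousOn ↿F (Ioi 0 ×ˢ Ioi 0))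
    (hdecay : HasDecay 1 F) (hF' : ContinuousOn ↿F' (Ioi 0 ×ˢ Ioi 0)) (hdecay' : HasDecay 1 F')
    (hderiv : ∀ v τ, 0 < v → 0 < τ → HasDerivAt (F v) (F' v τ) τ) (hu : 0 < u) (ht : 0 < t) :
    HasDerivAt (fun t => abelTransform (F · t) u) (abelTransform (F' · t) u) t := by
  obtain ⟨C, _, hC⟩ := hdecay'.abs_comp_add_half_sq_le (M := 0) (N := 1) (2 * t) (half_pos ht)
  refine (hasDerivAt_integral_of_dominated_loc_of_deriv_le
    (F := fun t w => F (u + w ^ 2 / 2) t) (F' := fun t w => F' (u + w ^ 2 / 2) t)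
    (bound := fun w => C * (1 + w ^ 2)⁻¹)
    (Ioo_mem_nhds (by linarith : t / 2 < t) (by linarith : t < 2 * t)) ?_
    (integrable_comp_add_half_sq hF hdecay hu ht)
    (continuous_comp_add_half_sq hF' hu ht).aestronglyMeasurable ?_
    (integrable_inv_one_add_sq.const_mul C) ?_).2
  · filter_upwards [Ioi_mem_nhds ht] with τ hτ
      using (continuous_comp_add_half_sq hF hu hτ).aestronglyMeasurable
  · exact ae_of_all _ fun w τ hτ => by simpa using hC u τ w hu hτ.1.le hτ.2.le
  · exact ae_of_all _ fun w τ hτ => hderiv _ τ (by positivity) ((half_pos ht).trans hτ.1)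

lemma continuousOn_abelTransform (hF : ContinuousOn ↿F (Ioi 0 ×ˢ Ioi 0)) (hdecay : HasDecay 1 F) :
    ContinuousOn ↿(fun u t => abelTransform (F · t) u) (Ioi 0 ×ˢ Ioi 0) := by
  rintro ⟨u, t⟩ ⟨hu : 0 < u, ht : 0 < t⟩
  refine ContinuousAt.continuousWithinAt ?_
  obtain ⟨C, _, hC⟩ := hdecay.abs_comp_add_half_sq_le (M := 0) (N := 1) (2 * t) (half_pos ht)
  have hnhds : Ioi 0 ×ˢ Ioo (t / 2) (2 * t) ∈ 𝓝 (u, t) :=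
    prod_mem_nhds (Ioi_mem_nhds hu) (Ioo_mem_nhds (by linarith) (by linarith))
  refine continuousAt_of_dominated (bound := fun w => C * (1 + w ^ 2)⁻¹) ?_ ?_
    (integrable_inv_one_add_sq.const_mul C) (ae_of_all _ fun w => ?_)
  · filter_upwards [hnhds] with p hp using
      (continuous_comp_add_half_sq hF hp.1 ((half_pos ht).trans hp.2.1)).aestronglyMeasurable
  · filter_upwards [hnhds] with p hp
    exact ae_of_all _ fun w => by simpa using hC p.1 p.2 w hp.1 hp.2.1.le hp.2.2.le
  · have huw : 0 < u + w ^ 2 / 2 := by positivity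
    exact ContinuousAt.comp (f := fun p : ℝ × ℝ => (p.1 + w ^ 2 / 2, p.2))
      (hF.continuousAt (prod_mem_nhds (Ioi_mem_nhds huw) (Ioi_mem_nhds ht))) (by fun_prop)

lemma hasDecay_abelTransform {N : ℕ} (hdecay : HasDecay (N + 1) F) :
    HasDecay N fun u t => abelTransform (F · t) u := by
  intro t₁ t₂ h₁
  obtain ⟨C, hC0, hC⟩ := hdecay.abs_comp_add_half_sq_le (M := N) (N := 1) t₂ h₁
  refine ⟨C * Real.pi, mul_nonneg hC0 Real.pi_pos.le, fun u t hu ht₁ ht₂ => ?_⟩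
  have hbound (w : ℝ) : ‖F (u + w ^ 2 / 2) t‖ ≤ C / (1 + u) ^ N * (1 + w ^ 2)⁻¹ := by
    simpa using hC u t w hu ht₁ ht₂
  calc |∫ w : ℝ, F (u + w ^ 2 / 2) t|
      ≤ ∫ w : ℝ, C / (1 + u) ^ N * (1 + w ^ 2)⁻¹ :=
        norm_integral_le_of_norm_le (integrable_inv_one_add_sq.const_mul _) (ae_of_all _ hbound)
    _ = C * Real.pi / (1 + u) ^ N := by
        rw [integral_const_mul, integral_univ_inv_one_add_sq]
        ring

end AbelTransform

section IntegrationByParts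

variable {f₀ f₁ f₂ : ℝ → ℝ} {u : ℝ}

lemma integral_pow_add_two_mul_comp_add_half_sq (k : ℕ)
    (h₁ : ∀ v, 0 < v → HasDerivAt f₀ (-f₁ v) v)
    (hf₀ : ∀ k, Integrable fun w : ℝ => w ^ k * f₀ (u + w ^ 2 / 2))
    (hf₁ : Integrable fun w : ℝ => w ^ (k + 2) * f₁ (u + w ^ 2 / 2)) (hu : 0 < u) :
    ∫ w : ℝ, w ^ (k + 2) * f₁ (u + w ^ 2 / 2) = (k + 1) * ∫ w : ℝ, w ^ k * f₀ (u + w ^ 2 / 2) := by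
  have hzero : ∫ w : ℝ, ((k + 1) * (w ^ k * f₀ (u + w ^ 2 / 2)) -
      w ^ (k + 2) * f₁ (u + w ^ 2 / 2)) = 0 := by
    refine integral_eq_zero_of_hasDerivAt_of_integrable (fun w => ?_)
      (((hf₀ k).const_mul _).sub hf₁) (hf₀ (k + 1))
    refine ((hasDerivAt_pow (k + 1) w).mul (hasDerivAt_comp_add_half_sq
      (h₁ (u + w ^ 2 / 2) (by positivity)))).congr_deriv ?_
    push_cast
    ring
  rw [integral_sub ((hf₀ k).const_mul _) hf₁, integral_const_mul] at hzero
  linarith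

/-- The Abel transform lowers the dimension by one, that is, the parameter `m` by `1/2`. -/
lemma abelTransform_radialHeatOp (m : ℝ) (h₁ : ∀ v, 0 < v → HasDerivAt f₀ (-f₁ v) v)
    (h₂ : ∀ v, 0 < v → HasDerivAt f₁ (-f₂ v) v)
    (hf₀ : ∀ k, Integrable fun w : ℝ => w ^ k * f₀ (u + w ^ 2 / 2))
    (hf₁ : ∀ k, Integrable fun w : ℝ => w ^ k * f₁ (u + w ^ 2 / 2))
    (hf₂ : ∀ k, Integrable fun w : ℝ => w ^ k * f₂ (u + w ^ 2 / 2)) (hu : 0 < u) :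
    abelTransform (radialHeatOp m f₀ f₁ f₂) u =
      radialHeatOp (m - 1 / 2) (abelTransform f₀) (abelTransform f₁) (abelTransform f₂) u := by
  have hparts₀ := integral_pow_add_two_mul_comp_add_half_sq 0 h₁ hf₀ (hf₁ 2) hu
  have hparts₁ := integral_pow_add_two_mul_comp_add_half_sq 0 h₂ hf₁ (hf₂ 2) hu
  have hparts₂ := integral_pow_add_two_mul_comp_add_half_sq 2 h₂ hf₁ (hf₂ 4) hu
  have hexpand (w : ℝ) : radialHeatOp m f₀ f₁ f₂ (u + w ^ 2 / 2) =
      (u ^ 2 - 1) * (w ^ 0 * f₂ (u + w ^ 2 / 2)) + u * (w ^ 2 * f₂ (u + w ^ 2 / 2)) +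
        4⁻¹ * (w ^ 4 * f₂ (u + w ^ 2 / 2)) +
        -(2 * m + 1) * u * (w ^ 0 * f₁ (u + w ^ 2 / 2)) +
        -(m + 1 / 2) * (w ^ 2 * f₁ (u + w ^ 2 / 2)) + m ^ 2 * (w ^ 0 * f₀ (u + w ^ 2 / 2)) := by
    rw [radialHeatOp]
    ring
  have hint₂ (k : ℕ) (c : ℝ) := (hf₂ k).const_mul c
  have hint₁ (k : ℕ) (c : ℝ) := (hf₁ k).const_mul c
  simp only [abelTransform, hexpand]
  rw [integral_add (by fun_prop) ((hf₀ 0).const_mul _), integral_add (by fun_prop) (hint₁ 2 _),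
    integral_add (by fun_prop) (hint₁ 0 _), integral_add (by fun_prop) (hint₂ 4 _),
    integral_add (hint₂ 0 _) (hint₂ 2 _)]
  simp only [integral_const_mul, hparts₂, hparts₁, hparts₀, pow_zero, one_mul, radialHeatOp,
    abelTransform]
  push_cast
  ring

end IntegrationByParts

section AbelTransformTwice

variable {F₀ F₁ : ℝ → ℝ → ℝ} {u t : ℝ}

lemma integral_Ioi_mul_comp_add_half_sq (hdecay₀ : HasDecay 1 F₀)
    (hF₁ : ContinuousOn ↿F₁ (Ioi 0 ×ˢ Ioi 0)) (hdecay₁ : HasDecay 2 F₁)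
    (hderiv : ∀ v, 0 < v → HasDerivAt (F₀ · t) (-F₁ v t) v) (hu : 0 < u) (ht : 0 < t) :
    ∫ r in Ioi (0 : ℝ), r * F₁ (u + r ^ 2 / 2) t = F₀ u t := by
  have hlim : Tendsto (fun r : ℝ => -F₀ (u + r ^ 2 / 2) t) atTop (𝓝 (-0)) :=
    ((hdecay₀.tendsto_atTop ht).comp (tendsto_atTop_add_const_left _ _
      ((tendsto_pow_atTop two_ne_zero).atTop_div_const two_pos))).neg
  have hderiv' (r : ℝ) : HasDerivAt (fun r => -F₀ (u + r ^ 2 / 2) t)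
      (r * F₁ (u + r ^ 2 / 2) t) r :=
    (hasDerivAt_comp_add_half_sq (hderiv (u + r ^ 2 / 2) (by positivity))).neg.congr_deriv (by ring)
  have hint : IntegrableOn (fun r => r * F₁ (u + r ^ 2 / 2) t) (Ioi 0) := by
    simpa using (integrable_pow_mul_comp_add_half_sq (k := 1) hF₁ hdecay₁ hu ht).integrableOn
  rw [integral_Ioi_of_hasDerivAt_of_tendsto' (fun r _ => hderiv' r) hint hlim]
  simp

lemma integrable_prod_comp_add_half_sq (hF₁ : ContinuousOn ↿F₁ (Ioi 0 ×ˢ Ioi 0))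
    (hdecay₁ : HasDecay 2 F₁) (hu : 0 < u) (ht : 0 < t) :
    Integrable fun p : ℝ × ℝ => F₁ (u + p.1 ^ 2 / 2 + p.2 ^ 2 / 2) t := by
  obtain ⟨C, hC0, hC⟩ := hdecay₁ t t ht
  have hcont : Continuous fun p : ℝ × ℝ => F₁ (u + p.1 ^ 2 / 2 + p.2 ^ 2 / 2) t :=
    hF₁.comp_continuous (f := fun p : ℝ × ℝ => (u + p.1 ^ 2 / 2 + p.2 ^ 2 / 2, t)) (by fun_prop)
      fun p => ⟨by simp only [mem_Ioi]; positivity, ht⟩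
  refine ((integrable_inv_one_add_sq.mul_prod integrable_inv_one_add_sq).const_mul (4 * C)).mono'
    hcont.aestronglyMeasurable (ae_of_all _ fun ⟨w, v⟩ => ?_)
  have hprod : (1 + w ^ 2) * (1 + v ^ 2) ≤ 4 * (1 + (u + w ^ 2 / 2 + v ^ 2 / 2)) ^ 2 := by
    nlinarith [sq_nonneg w, sq_nonneg v, sq_nonneg (w ^ 2 - v ^ 2),
      sq_nonneg (u + w ^ 2 / 2 + v ^ 2 / 2)]
  calc |F₁ (u + w ^ 2 / 2 + v ^ 2 / 2) t|
      ≤ C / (1 + (u + w ^ 2 / 2 + v ^ 2 / 2)) ^ 2 := hC _ t (by positivity) le_rfl le_rfl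
    _ ≤ C * (4 / ((1 + w ^ 2) * (1 + v ^ 2))) := by
        rw [div_eq_mul_one_div]
        refine mul_le_mul_of_nonneg_left ?_ hC0
        rwa [div_le_div_iff₀ (by positivity) (by positivity), one_mul]
    _ = 4 * C * ((1 + w ^ 2)⁻¹ * (1 + v ^ 2)⁻¹) := by
        rw [← mul_inv]
        ring

/-- Two Abel transforms integrate a radial function over a plane, hence invert differentiation. -/
lemma abelTransform_abelTransform (hdecay₀ : HasDecay 1 F₀)
    (hF₁ : ContinuousOn ↿F₁ (Ioi 0 ×ˢ Ioi 0)) (hdecay₁ : HasDecay 2 F₁)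
    (hderiv : ∀ v, 0 < v → HasDerivAt (F₀ · t) (-F₁ v t) v) (hu : 0 < u) (ht : 0 < t) :
    abelTransform (abelTransform (F₁ · t)) u = 2 * Real.pi * F₀ u t := by
  have hnorm (z : ℂ) : u + z.re ^ 2 / 2 + z.im ^ 2 / 2 = u + ‖z‖ ^ 2 / 2 := by
    rw [Complex.sq_norm, Complex.normSq_apply]
    ring
  calc abelTransform (abelTransform (F₁ · t)) u
      = ∫ p : ℝ × ℝ, F₁ (u + p.1 ^ 2 / 2 + p.2 ^ 2 / 2) t :=
        (integral_prod _ (integrable_prod_comp_add_half_sq hF₁ hdecay₁ hu ht)).symm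
    _ = ∫ z : ℂ, F₁ (u + z.re ^ 2 / 2 + z.im ^ 2 / 2) t :=
        (Complex.volume_preserving_equiv_real_prod.integral_comp
          Complex.measurableEquivRealProd.measurableEmbedding
          fun p : ℝ × ℝ => F₁ (u + p.1 ^ 2 / 2 + p.2 ^ 2 / 2) t).symm
    _ = 2 * Real.pi * ∫ r in Ioi (0 : ℝ), r * F₁ (u + r ^ 2 / 2) t := by
        simp_rw [hnorm]
        rw [integral_fun_norm_addHaar volume fun r => F₁ (u + r ^ 2 / 2) t]
        simp [Complex.finrank_real_complex, measureReal_def, Complex.volume_ball, mul_assoc]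
    _ = 2 * Real.pi * F₀ u t := by
        rw [integral_Ioi_mul_comp_add_half_sq hdecay₀ hF₁ hdecay₁ hderiv hu ht]

end AbelTransformTwice

/-! ### The radial profile in every dimension -/

lemma abelTransform_const_mul (c : ℝ) (f : ℝ → ℝ) :
    abelTransform (fun v => c * f v) = fun u => c * abelTransform f u :=
  funext fun _ => integral_const_mul _ _

/-- The heat kernel of hyperbolic space of dimension `d` is `exp (-((d - 1) / 2) ^ 2 * t)` times
this function of `u = cosh ρ` and `t`. The odd-dimensional ones are derivatives of the heat kernel
of the line; the even-dimensional ones are Abel transforms of the odd-dimensional ones. -/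
def profile (d : ℕ) (u t : ℝ) : ℝ :=
  if Odd d then ((2 * Real.pi) ^ (d / 2))⁻¹ * lineKernelDeriv (d / 2) u t
  else abelTransform (fun v => ((2 * Real.pi) ^ (d / 2))⁻¹ * lineKernelDeriv (d / 2) v t) u

lemma profile_two_mul_add_one (m : ℕ) :
    profile (2 * m + 1) = fun u t => ((2 * Real.pi) ^ m)⁻¹ * lineKernelDeriv m u t := by
  have hdiv : (2 * m + 1) / 2 = m := by omega
  simp [funext_iff, profile, hdiv]

lemma profile_two_mul (m : ℕ) :
    profile (2 * m) = fun u t => abelTransform (profile (2 * m + 1) · t) u := by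
  rw [profile_two_mul_add_one]
  simp [funext_iff, profile]

lemma profile_one_cosh (ρ t : ℝ) :
    profile 1 (Real.cosh ρ) t = (√(4 * Real.pi * t))⁻¹ * Real.exp (-ρ ^ 2 / (4 * t)) := by
  rw [← lineKernel_cosh, ← lineKernelDeriv_zero, profile_two_mul_add_one 0]
  simp

lemma continuousOn_profile (d : ℕ) : ContinuousOn ↿(profile d) (Ioi 0 ×ˢ Ioi 0) := by
  have hodd (m : ℕ) : ContinuousOn ↿(profile (2 * m + 1)) (Ioi 0 ×ˢ Ioi 0) := by
    rw [profile_two_mul_add_one]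
    exact continuousOn_const.mul (continuousOn_lineKernelDeriv m)
  have hdecay (m : ℕ) : HasDecay 1 (profile (2 * m + 1)) := by
    rw [profile_two_mul_add_one]
    exact (hasDecay_lineKernelDeriv m 1).const_mul _
  obtain ⟨m, rfl | rfl⟩ := Nat.even_or_odd' d
  · rw [profile_two_mul]
    exact continuousOn_abelTransform (hodd m) (hdecay m)
  · exact hodd m

lemma continuousOn_const_mul_profile (c : ℝ) (d : ℕ) :
    ContinuousOn ↿(fun u t => c * profile d u t) (Ioi 0 ×ˢ Ioi 0) :=
  continuousOn_const.mul (continuousOn_profile d)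

lemma hasDecay_profile (d N : ℕ) : HasDecay N (profile d) := by
  have hodd (m N : ℕ) : HasDecay N (profile (2 * m + 1)) := by
    rw [profile_two_mul_add_one]
    exact (hasDecay_lineKernelDeriv m N).const_mul _
  obtain ⟨m, rfl | rfl⟩ := Nat.even_or_odd' d
  · rw [profile_two_mul]
    exact hasDecay_abelTransform (hodd m (N + 1))
  · exact hodd m N

section Profile

variable (d : ℕ) {u t : ℝ}

lemma profile_pos (hu : 0 < u) (ht : 0 < t) : 0 < profile d u t := by
  have hodd (m : ℕ) {u : ℝ} (hu : 0 < u) : 0 < profile (2 * m + 1) u t := by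
    rw [profile_two_mul_add_one]
    have := lineKernelDeriv_pos m hu ht
    positivity
  obtain ⟨m, rfl | rfl⟩ := Nat.even_or_odd' d
  · rw [profile_two_mul]
    exact abelTransform_pos (continuousOn_profile _) (hasDecay_profile _ 1)
      (fun v hv => hodd m hv) hu ht
  · exact hodd m hu

lemma hasDerivAt_profile (hu : 0 < u) (ht : 0 < t) :
    HasDerivAt (profile d · t) (-(2 * Real.pi * profile (d + 2) u t)) u := by
  have hodd (m : ℕ) {u : ℝ} (hu : 0 < u) : HasDerivAt (profile (2 * m + 1) · t)
      (-(2 * Real.pi) * profile (2 * (m + 1) + 1) u t) u := by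
    simp only [profile_two_mul_add_one]
    refine ((hasDerivAt_lineKernelDeriv m hu t).const_mul _).congr_deriv ?_
    rw [pow_succ]
    field_simp
  rw [← neg_mul]
  obtain ⟨m, rfl | rfl⟩ := Nat.even_or_odd' d
  · have h := hasDerivAt_abelTransform (continuousOn_profile _) (hasDecay_profile _ 1)
      (F' := fun u t => -(2 * Real.pi) * profile (2 * (m + 1) + 1) u t)
      (continuousOn_const_mul_profile _ _) ((hasDecay_profile _ 1).const_mul _)
      (fun v hv => hodd m hv) hu ht
    rw [abelTransform_const_mul] at h
    rw [show 2 * m + 2 = 2 * (m + 1) by ring]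
    simpa only [profile_two_mul] using h
  · exact hodd m hu

lemma strictAntiOn_profile (ht : 0 < t) : StrictAntiOn (profile d · t) (Ioi 0) := by
  refine strictAntiOn_of_hasDerivWithinAt_neg (convex_Ioi 0)
    (fun u hu => (hasDerivAt_profile d hu ht).continuousAt.continuousWithinAt)
    (fun u hu => (hasDerivAt_profile d (interior_subset hu) ht).hasDerivWithinAt) fun u hu => ?_
  have := Real.pi_pos
  have := profile_pos (d + 2) (interior_subset hu) ht
  rw [neg_lt_zero]
  positivity

lemma hasDerivAt_profile_two_mul_add_one_time (m : ℕ) (hu : 0 < u) (ht : 0 < t) :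
    HasDerivAt (profile (2 * m + 1) u) (radialHeatOp m (profile (2 * m + 1) · t)
      (fun v => 2 * Real.pi * profile (2 * (m + 1) + 1) v t)
      (fun v => (2 * Real.pi) ^ 2 * profile (2 * (m + 2) + 1) v t) u) t := by
  simp only [profile_two_mul_add_one]
  refine ((hasDerivAt_lineKernelDeriv_time m hu ht).const_mul _).congr_deriv ?_
  simp only [radialHeatOp, pow_add, pow_one]
  field_simp

/-- In even dimension, integrate the heat equation in the next dimension over horocycles. -/
lemma hasDerivAt_profile_two_mul_time (m : ℕ) (hu : 0 < u) (ht : 0 < t) :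
    HasDerivAt (profile (2 * m) u) (radialHeatOp (m - 1 / 2) (profile (2 * m) · t)
      (fun v => 2 * Real.pi * profile (2 * (m + 1)) v t)
      (fun v => (2 * Real.pi) ^ 2 * profile (2 * (m + 2)) v t) u) t := by
  have hcont (c : ℝ) (k : ℕ) := continuousOn_const_mul_profile c (2 * k + 1)
  have hdecay (c : ℝ) (k N : ℕ) := (hasDecay_profile (2 * k + 1) N).const_mul c
  have hint (c : ℝ) (i k : ℕ) :=
    integrable_pow_mul_comp_add_half_sq (hcont c i) (hdecay c i (k + 1)) hu ht
  have hderiv (c : ℝ) (k : ℕ) (v : ℝ) (hv : 0 < v) :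
      HasDerivAt (fun v => c * profile (2 * k + 1) v t)
        (-(c * (2 * Real.pi) * profile (2 * (k + 1) + 1) v t)) v :=
    ((hasDerivAt_profile (2 * k + 1) hv ht).const_mul c).congr_deriv (by ring_nf)
  have h := hasDerivAt_abelTransform_time (hcont 1 m) (hdecay 1 m 1)
    (continuousOn_radialHeatOp m (hcont 1 m) (hcont (1 * (2 * Real.pi)) (m + 1))
      (hcont (1 * (2 * Real.pi) * (2 * Real.pi)) (m + 2)))
    (.radialHeatOp m (hdecay _ m 1) (hdecay _ (m + 1) 2) (hdecay _ (m + 2) 3))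
    (fun v τ hv hτ => by
      simpa [sq] using hasDerivAt_profile_two_mul_add_one_time m hv hτ) hu ht
  rw [abelTransform_radialHeatOp m (hderiv _ m) (hderiv _ (m + 1)) (hint _ m) (hint _ (m + 1))
    (hint _ (m + 2)) hu] at h
  simpa [abelTransform_const_mul, profile_two_mul, sq] using h

lemma hasDerivAt_profile_time (hu : 0 < u) (ht : 0 < t) :
    HasDerivAt (profile d u) (radialHeatOp ((d - 1) / 2) (profile d · t)
      (fun v => 2 * Real.pi * profile (d + 2) v t)
      (fun v => (2 * Real.pi) ^ 2 * profile (d + 4) v t) u) t := by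
  obtain ⟨m, rfl | rfl⟩ := Nat.even_or_odd' d
  · convert! hasDerivAt_profile_two_mul_time m hu ht using 2
    push_cast
    ring
  · convert! hasDerivAt_profile_two_mul_add_one_time m hu ht using 2
    push_cast
    ring

lemma abelTransform_profile (hu : 0 < u) (ht : 0 < t) :
    abelTransform (profile (d + 1) · t) u = profile d u t := by
  obtain ⟨m, rfl | rfl⟩ := Nat.even_or_odd' d
  · rw [profile_two_mul]
  · have h := abelTransform_abelTransform
      (F₀ := fun u t => (2 * Real.pi)⁻¹ * profile (2 * m + 1) u t)
      ((hasDecay_profile _ 1).const_mul _) (continuousOn_profile (2 * (m + 1) + 1))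
      (hasDecay_profile _ 2) (fun v hv => ((hasDerivAt_profile (2 * m + 1) hv ht).const_mul
        (2 * Real.pi)⁻¹).congr_deriv (by field_simp; rfl)) hu ht
    rw [show 2 * m + 1 + 1 = 2 * (m + 1) by ring, profile_two_mul, h]
    field_simp

lemma lintegral_profile (hu : 0 < u) (ht : 0 < t) :
    ∫⁻ w : ℝ, ENNReal.ofReal (profile (d + 1) (u + w ^ 2 / 2) t) =
      ENNReal.ofReal (profile d u t) := by
  rw [← abelTransform_profile d hu ht, ofReal_abelTransform (continuousOn_profile _)
    (hasDecay_profile _ 1) (fun v hv => (profile_pos _ hv ht).le) hu ht]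

end Profile

/-! ### Integration over horospheres -/

section ProfileIntegral

variable {u t : ℝ}

lemma lintegral_comp_smul_sub {E : Type*} [NormedAddCommGroup E] [NormedSpace ℝ E]
    [MeasurableSpace E] [BorelSpace E] [FiniteDimensional ℝ E] (μ : Measure E) [μ.IsAddHaarMeasure]
    (f : E → ENNReal) (y : E) {a : ℝ} (ha : a ≠ 0) :
    ∫⁻ x, f (a • (x - y)) ∂μ = ENNReal.ofReal |(a ^ Module.finrank ℝ E)⁻¹| * ∫⁻ x, f x ∂μ := by
  calc ∫⁻ x, f (a • (x - y)) ∂μ = ∫⁻ x, f (a • x) ∂μ :=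
        lintegral_sub_right_eq_self (fun x => f (a • x)) y
    _ = ∫⁻ x, f x ∂Measure.map (a • ·) μ :=
        (lintegral_map_equiv f (MeasurableEquiv.smul₀ a ha)).symm
    _ = _ := by rw [Measure.map_addHaar_smul μ ha, lintegral_smul_measure, smul_eq_mul]

lemma continuousOn_profile_comp (d : ℕ) {X : Type*} [TopologicalSpace X] {f τ : X → ℝ} {s : Set X}
    (hf : ContinuousOn f s) (hf0 : ∀ x ∈ s, 0 < f x) (hτ : ContinuousOn τ s)
    (hτ0 : ∀ x ∈ s, 0 < τ x) : ContinuousOn (fun x => profile d (f x) (τ x)) s :=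
  (continuousOn_profile d).comp (f := fun x => (f x, τ x)) (hf.prodMk hτ)
    fun x hx => ⟨hf0 x hx, hτ0 x hx⟩

lemma lintegral_profile_add_sum_sq (d n : ℕ) (hu : 0 < u) (ht : 0 < t) :
    ∫⁻ w : Fin n → ℝ, ENNReal.ofReal (profile (d + n) (u + (∑ i, w i ^ 2) / 2) t) =
      ENNReal.ofReal (profile d u t) := by
  induction n generalizing d u with
  | zero =>
    rw [volume_pi, Measure.pi_of_empty, lintegral_dirac]
    simp
  | succ n ih =>
    have hpos (p : ℝ × (Fin n → ℝ)) : 0 < u + p.1 ^ 2 / 2 + (∑ i, p.2 i ^ 2) / 2 :=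
      add_pos_of_pos_of_nonneg (by positivity) (by positivity)
    have hmeas : AEMeasurable (fun p : ℝ × (Fin n → ℝ) => ENNReal.ofReal (profile (d + 1 + n)
        (u + p.1 ^ 2 / 2 + (∑ i, p.2 i ^ 2) / 2) t)) (volume.prod volume) :=
      (continuousOn_univ.1 (continuousOn_profile_comp _ (by fun_prop) (fun p _ => hpos p)
        continuousOn_const fun _ _ => ht)).measurable.ennreal_ofReal.aemeasurable
    have hslice (a : ℝ) : 0 < u + a ^ 2 / 2 := by positivity
    have hsplit (p : ℝ × (Fin n → ℝ)) :
        u + (∑ i, (MeasurableEquiv.piFinSuccAbove (fun _ => ℝ) 0).symm p i ^ 2) / 2 =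
          u + p.1 ^ 2 / 2 + (∑ i, p.2 i ^ 2) / 2 := by
      rw [Fin.sum_univ_succ]
      simp [MeasurableEquiv.piFinSuccAbove, Fin.insertNthEquiv, add_div, add_assoc]
    rw [← (volume_preserving_piFinSuccAbove (fun _ : Fin (n + 1) => ℝ) 0).symm.lintegral_comp_emb
      (MeasurableEquiv.measurableEmbedding _)]
    simp only [hsplit, ← add_assoc, add_right_comm d n 1]
    rw [Measure.volume_eq_prod, lintegral_prod _ hmeas]
    simp only [ih (d + 1) (hslice _), lintegral_profile d hu ht]

lemma lintegral_profile_add_sum_sub_sq (d n : ℕ) {r : ℝ} (hu : 0 < u) (ht : 0 < t) (hr : 0 < r)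
    (y : Fin n → ℝ) :
    ∫⁻ w : Fin n → ℝ, ENNReal.ofReal (profile (d + n) (u + (∑ i, (w i - y i) ^ 2) / (2 * r)) t) =
      ENNReal.ofReal (√r ^ n * profile d u t) := by
  have hscale (w : Fin n → ℝ) :
      (∑ i, (w i - y i) ^ 2) / (2 * r) = (∑ i, (((√r)⁻¹ • (w - y)) i) ^ 2) / 2 := by
    simp only [Pi.smul_apply, Pi.sub_apply, smul_eq_mul, mul_pow, inv_pow, Real.sq_sqrt hr.le,
      ← Finset.mul_sum]
    field_simp
  simp only [hscale]
  rw [lintegral_comp_smul_sub volume (fun w : Fin n → ℝ => ENNReal.ofReal (profile (d + n)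
      (u + (∑ i, w i ^ 2) / 2) t)) y (by positivity), lintegral_profile_add_sum_sq d n hu ht,
    Module.finrank_fin_fun, ← inv_pow, inv_inv, abs_of_pos (by positivity),
    ← ENNReal.ofReal_mul (by positivity)]

lemma setLIntegral_Ioi_zero_eq_lintegral_mul_exp {c : ℝ} (hc : 0 < c) (f : ℝ → ENNReal) :
    ∫⁻ a in Ioi 0, f a = ∫⁻ b, ENNReal.ofReal (c * Real.exp b) * f (c * Real.exp b) := by
  have himage : (fun b => c * Real.exp b) '' univ = Ioi 0 := by
    rw [← Function.comp_def (c * ·), image_comp, image_univ, Real.range_exp,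
      image_mul_left_Ioi hc, mul_zero]
  rw [← himage, lintegral_image_eq_lintegral_abs_deriv_mul MeasurableSet.univ
    (fun b _ => ((Real.hasDerivAt_exp b).const_mul c).hasDerivWithinAt)
    (fun b _ b' _ h => Real.exp_injective (mul_left_cancel₀ hc.ne' h)), setLIntegral_univ]
  exact lintegral_congr fun b => by rw [abs_of_pos (by positivity)]

end ProfileIntegral

section Horosphere

variable {d : ℕ} [NeZero d] {u t : ℝ} {x y : Coord d}

lemma measurableSet_hypSpace : MeasurableSet (hypSpace d) :=
  measurableSet_lt measurable_const (by fun_prop)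

lemma isOpen_hypSpace : IsOpen (hypSpace d) := isOpen_lt continuous_const (by fun_prop)

lemma volumeDensity_hypMetric (hx : x ∈ hypSpace d) :
    volumeDensity (hypMetric d) x = (x 0 ^ d)⁻¹ := by
  have hx0 : 0 < x 0 := hx
  rw [volumeDensity, hypMetric, Matrix.det_diagonal, Finset.prod_const, Finset.card_univ,
    Fintype.card_fin, one_div, inv_pow, ← pow_mul, mul_comm 2, pow_mul, Real.sqrt_inv,
    Real.sqrt_sq (by positivity)]

lemma measurable_volumeDensity_hypMetric : Measurable (volumeDensity (hypMetric d)) := by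
  unfold volumeDensity hypMetric
  simp only [Matrix.det_diagonal]
  fun_prop

lemma ae_mem_hypSpace : ∀ᵐ x ∂hypVolume d, x ∈ hypSpace d :=
  (withDensity_absolutelyContinuous _ _).ae_le (ae_restrict_mem measurableSet_hypSpace)

lemma lintegral_hypVolume {f : Coord d → ENNReal}
    (hf : AEMeasurable f (volume.restrict (hypSpace d))) :
    ∫⁻ x, f x ∂hypVolume d = ∫⁻ x in hypSpace d, ENNReal.ofReal (x 0 ^ d)⁻¹ * f x := by
  rw [hypVolume, lintegral_withDensity_eq_lintegral_mul₀
    measurable_volumeDensity_hypMetric.ennreal_ofReal.aemeasurable hf]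
  refine setLIntegral_congr_fun measurableSet_hypSpace fun x hx => ?_
  simp only [Pi.mul_apply, volumeDensity_hypMetric hx]

/-- The coordinates `(x 0, (x 1, …, x n))`: the height of a point in the half-space, and its
position on the horosphere of that height. -/
def horosphereCoord (n : ℕ) : ℝ × (Fin n → ℝ) ≃ᵐ Coord (n + 1) :=
  (MeasurableEquiv.piFinSuccAbove (fun _ => ℝ) 0).symm.trans (MeasurableEquiv.toLp 2 _)

lemma horosphereCoord_zero {n : ℕ} (p : ℝ × (Fin n → ℝ)) : horosphereCoord n p 0 = p.1 := rfl

lemma horosphereCoord_succ {n : ℕ} (p : ℝ × (Fin n → ℝ)) (i : Fin n) :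
    horosphereCoord n p i.succ = p.2 i := by
  simp [horosphereCoord, MeasurableEquiv.piFinSuccAbove, Fin.insertNthEquiv]

lemma measurePreserving_horosphereCoord (n : ℕ) : MeasurePreserving (horosphereCoord n) :=
  (volume_preserving_piFinSuccAbove (fun _ : Fin (n + 1) => ℝ) 0).symm.trans
    (EuclideanSpace.volume_preserving_symm_measurableEquiv_toLp (Fin (n + 1))).symm

lemma lintegral_hypVolume_horosphereCoord (n : ℕ) {c : ℝ} (hc : 0 < c)
    {f : Coord (n + 1) → ENNReal}
    (hf : AEMeasurable f (volume.restrict (hypSpace (n + 1)))) :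
    ∫⁻ x, f x ∂hypVolume (n + 1) = ∫⁻ b, ENNReal.ofReal ((c * Real.exp b) ^ n)⁻¹ *
      ∫⁻ w, f (horosphereCoord n (c * Real.exp b, w)) := by
  have hpreimage : horosphereCoord n ⁻¹' hypSpace (n + 1) = Ioi 0 ×ˢ univ := by
    ext p
    simp [hypSpace, horosphereCoord_zero]
  have hmp := (measurePreserving_horosphereCoord n).restrict_preimage
    (measurableSet_hypSpace (d := n + 1))
  rw [hpreimage, Measure.volume_eq_prod, ← Measure.prod_restrict, Measure.restrict_univ] at hmp
  have hmeas : AEMeasurable (fun x : Coord (n + 1) => ENNReal.ofReal (x 0 ^ (n + 1))⁻¹ * f x)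
      (volume.restrict (hypSpace (n + 1))) :=
    AEMeasurable.mul (Measurable.aemeasurable (by fun_prop)) hf
  have hjacobian (b : ℝ) : ENNReal.ofReal (c * Real.exp b) *
      ENNReal.ofReal ((c * Real.exp b) ^ (n + 1))⁻¹ = ENNReal.ofReal ((c * Real.exp b) ^ n)⁻¹ := by
    rw [← ENNReal.ofReal_mul (by positivity)]
    congr 1
    field_simp
    ring
  rw [lintegral_hypVolume hf, ← hmp.lintegral_comp_emb (MeasurableEquiv.measurableEmbedding _)]
  refine (lintegral_prod _
    (hmeas.comp_quasiMeasurePreserving hmp.quasiMeasurePreserving)).trans ?_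
  rw [setLIntegral_Ioi_zero_eq_lintegral_mul_exp hc]
  simp only [Function.comp_apply, horosphereCoord_zero,
    lintegral_const_mul' _ _ ENNReal.ofReal_ne_top, ← mul_assoc, hjacobian]

/-- Each horosphere integral of the profile in dimension `n + 1` is a profile in dimension `1`,
by `lintegral_profile_add_sum_sub_sq`. -/
lemma lintegral_hypVolume_profile (n : ℕ) {α : ℝ → ℝ} (hα : Continuous α) (hα0 : ∀ b, 0 < α b)
    {s : ℝ} (hs : 0 < s) (ht : 0 < t) {y : Coord (n + 1)} (hy : 0 < y 0) :
    ∫⁻ x, ENNReal.ofReal (profile (n + 1) (α (Real.log (x 0 / y 0)) +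
      (∑ i : Fin n, (x i.succ - y i.succ) ^ 2) / (2 * (s * (x 0 * y 0)))) t) ∂hypVolume (n + 1) =
    ∫⁻ b, ENNReal.ofReal (√s ^ n * Real.exp (-(n / 2) * b) * profile 1 (α b) t) := by
  have hmeas : AEMeasurable (fun x : Coord (n + 1) => ENNReal.ofReal (profile (n + 1)
      (α (Real.log (x 0 / y 0)) + (∑ i : Fin n, (x i.succ - y i.succ) ^ 2) /
        (2 * (s * (x 0 * y 0)))) t)) (volume.restrict (hypSpace (n + 1))) := by
    have hden : ∀ x ∈ hypSpace (n + 1), 2 * (s * (x 0 * y 0)) ≠ 0 := fun x (hx : 0 < x 0) => by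
      positivity
    have hlog : ContinuousOn (fun x : Coord (n + 1) => Real.log (x 0 / y 0)) (hypSpace (n + 1)) :=
      ContinuousOn.log (by fun_prop) fun x (hx : 0 < x 0) => (div_pos hx hy).ne'
    refine ((continuousOn_profile_comp _ ((hα.comp_continuousOn hlog).add
      (ContinuousOn.div (by fun_prop) (by fun_prop) hden)) (fun x hx => ?_) continuousOn_const
      fun _ _ => ht).aemeasurable measurableSet_hypSpace).ennreal_ofReal
    have hx0 : 0 < x 0 := hx
    exact add_pos_of_pos_of_nonneg (hα0 _) (div_nonneg (by positivity) (by positivity))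
  rw [lintegral_hypVolume_horosphereCoord n hy hmeas]
  refine lintegral_congr fun b => ?_
  have hlog : Real.log (y 0 * Real.exp b / y 0) = b := by
    rw [mul_div_cancel_left₀ _ hy.ne', Real.log_exp]
  simp only [horosphereCoord_zero, horosphereCoord_succ, hlog]
  have hexp : Real.exp b = Real.exp (b / 2) ^ 2 := by
    rw [← Real.exp_nat_mul]
    ring_nf
  have hexp_neg : Real.exp (-(n / 2) * b) = (Real.exp (b / 2) ^ n)⁻¹ := by
    rw [← Real.exp_nat_mul, ← Real.exp_neg]
    ring_nf
  have hsqrt : √(s * (y 0 * Real.exp b * y 0)) = √s * (y 0 * Real.exp (b / 2)) := by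
    rw [Real.sqrt_mul hs.le, hexp, show y 0 * Real.exp (b / 2) ^ 2 * y 0 =
      (y 0 * Real.exp (b / 2)) ^ 2 by ring, Real.sqrt_sq (by positivity)]
  simp only [add_comm n 1]
  rw [lintegral_profile_add_sum_sub_sq 1 n (hα0 b) ht (by positivity) fun i => y i.succ,
    ← ENNReal.ofReal_mul (by positivity), hsqrt, hexp_neg, hexp]
  congr 1
  field_simp
  ring

end Horosphere

/-! ### The heat kernel and its mass -/

section Kernel

variable {d : ℕ} [NeZero d] {x y : Coord d} {t : ℝ}

/-- The hyperbolic cosine of the hyperbolic distance. -/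
def hypCosh (x y : Coord d) : ℝ := 1 + dist x y ^ 2 / (2 * (x 0 * y 0))

lemma cosh_hypDist (hx : x ∈ hypSpace d) (hy : y ∈ hypSpace d) :
    Real.cosh (hypDist d x y) = hypCosh x y := by
  have hxy : 0 < x 0 * y 0 := mul_pos hx hy
  rw [hypDist, Real.cosh_two_mul, Real.cosh_sq, Real.sinh_arsinh, hypCosh, div_pow, mul_pow,
    Real.sq_sqrt hxy.le]
  field_simp
  ring

lemma one_le_hypCosh (hx : x ∈ hypSpace d) (hy : y ∈ hypSpace d) : 1 ≤ hypCosh x y :=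
  cosh_hypDist hx hy ▸ Real.one_le_cosh _

lemma hypCosh_pos (hx : x ∈ hypSpace d) (hy : y ∈ hypSpace d) : 0 < hypCosh x y :=
  zero_lt_one.trans_le (one_le_hypCosh hx hy)

lemma hypCosh_comm (x y : Coord d) : hypCosh x y = hypCosh y x := by
  rw [hypCosh, hypCosh, dist_comm, mul_comm (x 0)]

lemma measurableSet_le_hypCosh (m : ℝ) (y : Coord d) : MeasurableSet {x | m ≤ hypCosh x y} := by
  unfold hypCosh
  measurability

lemma continuousOn_hypCosh : ContinuousOn ↿(hypCosh (d := d)) (hypSpace d ×ˢ hypSpace d) :=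
  continuousOn_const.add (ContinuousOn.div (by fun_prop) (by fun_prop) fun p hp =>
    mul_ne_zero two_ne_zero (mul_pos hp.1 hp.2).ne')

lemma hypCosh_eq_cosh_log_add {n : ℕ} {x y : Coord (n + 1)} (hx : x ∈ hypSpace (n + 1))
    (hy : y ∈ hypSpace (n + 1)) :
    hypCosh x y = Real.cosh (Real.log (x 0 / y 0)) +
      (∑ i : Fin n, (x i.succ - y i.succ) ^ 2) / (2 * (x 0 * y 0)) := by
  have hx0 : 0 < x 0 := hx
  have hy0 : 0 < y 0 := hy
  rw [hypCosh, EuclideanSpace.dist_sq_eq, Fin.sum_univ_succ, Real.cosh_log (div_pos hx0 hy0)]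
  simp only [Real.dist_eq, sq_abs]
  field_simp
  ring

/-- The heat kernel of hyperbolic space. -/
def hypKernel (x y : Coord d) (t : ℝ) : ℝ :=
  Real.exp (-((d - 1) / 2 : ℝ) ^ 2 * t) * profile d (hypCosh x y) t

lemma hypKernel_pos (hx : x ∈ hypSpace d) (hy : y ∈ hypSpace d) (ht : 0 < t) :
    0 < hypKernel x y t :=
  mul_pos (Real.exp_pos _) (profile_pos d (hypCosh_pos hx hy) ht)

lemma hypKernel_comm (x y : Coord d) (t : ℝ) : hypKernel x y t = hypKernel y x t := by
  rw [hypKernel, hypCosh_comm, hypKernel]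

lemma lintegral_exp_linear_sub_sq (c : ℝ) (ht : 0 < t) :
    ∫⁻ b : ℝ, ENNReal.ofReal (Real.exp (c * b - b ^ 2 / (4 * t))) =
      ENNReal.ofReal (√(4 * Real.pi * t) * Real.exp (c ^ 2 * t)) := by
  have hgaussian (b : ℝ) : Real.exp (c * b - b ^ 2 / (4 * t)) =
      √(4 * Real.pi * t) * Real.exp (c ^ 2 * t) *
        ProbabilityTheory.gaussianPDFReal (2 * t * c) (2 * t).toNNReal b := by
    rw [ProbabilityTheory.gaussianPDFReal, Real.coe_toNNReal _ (by positivity),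
      show 2 * Real.pi * (2 * t) = 4 * Real.pi * t by ring,
      show c * b - b ^ 2 / (4 * t) = c ^ 2 * t + -(b - 2 * t * c) ^ 2 / (2 * (2 * t)) by
        field_simp; ring, Real.exp_add]
    field_simp
  simp only [hgaussian, ENNReal.ofReal_mul (show 0 ≤ √(4 * Real.pi * t) * Real.exp (c ^ 2 * t) by
    positivity)]
  rw [lintegral_const_mul' _ _ ENNReal.ofReal_ne_top,
    ProbabilityTheory.lintegral_gaussianPDFReal_eq_one _ (by simpa using ht), mul_one]

lemma lintegral_hypKernel (hy : y ∈ hypSpace d) (ht : 0 < t) :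
    ∫⁻ x, ENNReal.ofReal (hypKernel x y t) ∂hypVolume d = 1 := by
  obtain ⟨n, rfl⟩ := Nat.exists_eq_add_one_of_ne_zero (NeZero.ne d)
  have hslices (x : Coord (n + 1)) (hx : x ∈ hypSpace (n + 1)) :
      ENNReal.ofReal (hypKernel x y t) = ENNReal.ofReal (Real.exp (-(n / 2) ^ 2 * t)) *
        ENNReal.ofReal (profile (n + 1) (Real.cosh (Real.log (x 0 / y 0)) +
          (∑ i : Fin n, (x i.succ - y i.succ) ^ 2) / (2 * (1 * (x 0 * y 0)))) t) := by
    rw [← ENNReal.ofReal_mul (Real.exp_pos _).le, hypKernel, hypCosh_eq_cosh_log_add hx hy, one_mul]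
    push_cast
    rw [add_sub_cancel_right]
  have hgaussian (b : ℝ) : √1 ^ n * Real.exp (-(n / 2) * b) * profile 1 (Real.cosh b) t =
      (√(4 * Real.pi * t))⁻¹ * Real.exp (-(n / 2) * b - b ^ 2 / (4 * t)) := by
    rw [profile_one_cosh, sub_eq_add_neg, Real.exp_add, ← neg_div (4 * t), Real.sqrt_one, one_pow]
    ring
  rw [lintegral_congr_ae (ae_mem_hypSpace.mono hslices),
    lintegral_const_mul' _ _ ENNReal.ofReal_ne_top,
    lintegral_hypVolume_profile n Real.continuous_cosh (fun b => Real.cosh_pos b) one_pos ht hy]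
  simp only [hgaussian, ENNReal.ofReal_mul (inv_nonneg.2 (Real.sqrt_nonneg _))]
  rw [lintegral_const_mul' _ _ ENNReal.ofReal_ne_top, lintegral_exp_linear_sub_sq _ ht,
    ← ENNReal.ofReal_mul (by positivity), ← ENNReal.ofReal_mul (by positivity),
    inv_mul_cancel_left₀ (by positivity), ← Real.exp_add, neg_sq, neg_mul, neg_add_cancel,
    Real.exp_zero, ENNReal.ofReal_one]

lemma arcosh_sq_div_two_add_le {δ : ℝ} (hδ : 0 < δ) (b : ℝ) :
    Real.arcosh (1 + δ / 2) ^ 2 / 2 + b ^ 2 / 8 ≤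
      Real.arcosh (Real.cosh b / 2 + (1 + δ) / 2) ^ 2 := by
  have hb : 1 ≤ Real.cosh b := Real.one_le_cosh b
  have hδ_le : Real.arcosh (1 + δ / 2) ≤ Real.arcosh (Real.cosh b / 2 + (1 + δ) / 2) :=
    (Real.arcosh_le_arcosh (by linarith) (by linarith)).2 (by linarith)
  have hb_le : |b / 2| ≤ Real.arcosh (Real.cosh b / 2 + (1 + δ) / 2) := by
    rw [← abs_of_nonneg (Real.arcosh_nonneg (x := Real.cosh b / 2 + (1 + δ) / 2) (by linarith)),
      ← Real.cosh_le_cosh, Real.cosh_arcosh (by linarith)]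
    have hdouble := Real.cosh_two_mul (b / 2)
    rw [mul_div_cancel₀ b two_ne_zero, Real.sinh_sq] at hdouble
    nlinarith [Real.one_le_cosh (b / 2)]
  have hδ_sq := pow_le_pow_left₀ (Real.arcosh_nonneg (by linarith)) hδ_le 2
  have hb_sq := pow_le_pow_left₀ (abs_nonneg _) hb_le 2
  rw [sq_abs] at hb_sq
  linarith

lemma hypKernel_le_profile_of_one_add_le_hypCosh {n : ℕ} {x y : Coord (n + 1)} {δ : ℝ}
    (hx : x ∈ hypSpace (n + 1)) (hy : y ∈ hypSpace (n + 1)) (hδ : 0 < δ) (ht : 0 < t)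
    (hxy : 1 + δ ≤ hypCosh x y) :
    hypKernel x y t ≤ profile (n + 1) (Real.cosh (Real.log (x 0 / y 0)) / 2 + (1 + δ) / 2 +
      (∑ i : Fin n, (x i.succ - y i.succ) ^ 2) / (2 * (2 * (x 0 * y 0)))) t := by
  have hsum : 0 ≤ (∑ i : Fin n, (x i.succ - y i.succ) ^ 2) / (2 * (2 * (x 0 * y 0))) :=
    div_nonneg (by positivity) (mul_pos two_pos (mul_pos two_pos (mul_pos hx hy))).le
  have hhalf : Real.cosh (Real.log (x 0 / y 0)) / 2 +
      (∑ i : Fin n, (x i.succ - y i.succ) ^ 2) / (2 * (2 * (x 0 * y 0))) = hypCosh x y / 2 := by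
    rw [hypCosh_eq_cosh_log_add hx hy]
    ring
  have hpos := hypCosh_pos hx hy
  have := Real.cosh_pos (Real.log (x 0 / y 0))
  calc hypKernel x y t ≤ 1 * profile (n + 1) (hypCosh x y) t :=
        mul_le_mul_of_nonneg_right (Real.exp_le_one_iff.2 (by
          rw [neg_mul]; exact neg_nonpos.2 (by positivity))) (profile_pos _ hpos ht).le
    _ ≤ _ := by
      rw [one_mul]
      exact (strictAntiOn_profile (n + 1) ht).antitoneOn
        (mem_Ioi.2 (add_pos_of_pos_of_nonneg (by positivity) hsum)) hpos (by linarith)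

lemma profile_one_half_cosh_add_le {δ : ℝ} (hδ : 0 < δ) (b : ℝ) (ht : 0 < t) :
    profile 1 (Real.cosh b / 2 + (1 + δ) / 2) t ≤ (√(4 * Real.pi * t))⁻¹ *
      Real.exp (-(Real.arcosh (1 + δ / 2) ^ 2 / 8) * t⁻¹) *
        Real.exp (-(b ^ 2 / (4 * (8 * t)))) := by
  have hb : 1 ≤ Real.cosh b := Real.one_le_cosh b
  rw [← Real.cosh_arcosh (x := Real.cosh b / 2 + (1 + δ) / 2) (by linarith), profile_one_cosh,
    mul_assoc (_⁻¹), ← Real.exp_add]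
  gcongr
  calc _ ≤ -(Real.arcosh (1 + δ / 2) ^ 2 / 2 + b ^ 2 / 8) / (4 * t) := by
        gcongr
        exact arcosh_sq_div_two_add_le hδ b
    _ = _ := by
        field_simp
        ring

/-- Half of the displacement `hypCosh x y - 1` pays for the factor `exp (-c / t)`, and the other
half for the convergence of the horosphere integral, uniformly in `y`. -/
lemma lintegral_hypKernel_far_le {δ : ℝ} (hδ : 0 < δ) (hy : y ∈ hypSpace d) (ht : 0 < t) :
    ∫⁻ x in {x | 1 + δ ≤ hypCosh x y}, ENNReal.ofReal (hypKernel x y t) ∂hypVolume d ≤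
      ENNReal.ofReal (√2 ^ (d - 1) * √8 * Real.exp (2 * (d - 1) ^ 2 * t) *
        Real.exp (-(Real.arcosh (1 + δ / 2) ^ 2 / 8) * t⁻¹)) := by
  obtain ⟨n, rfl⟩ := Nat.exists_eq_add_one_of_ne_zero (NeZero.ne d)
  set E := Real.exp (-(Real.arcosh (1 + δ / 2) ^ 2 / 8) * t⁻¹)
  calc _ ≤ ∫⁻ x, ENNReal.ofReal (profile (n + 1) (Real.cosh (Real.log (x 0 / y 0)) / 2 +
        (1 + δ) / 2 + (∑ i : Fin n, (x i.succ - y i.succ) ^ 2) / (2 * (2 * (x 0 * y 0)))) t)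
          ∂hypVolume (n + 1) := by
        refine (lintegral_mono_ae ?_).trans (setLIntegral_le_lintegral {x | 1 + δ ≤ hypCosh x y} _)
        filter_upwards [ae_restrict_of_ae ae_mem_hypSpace,
          ae_restrict_mem (measurableSet_le_hypCosh _ y)] with x hx hxy
        exact ENNReal.ofReal_le_ofReal
          (hypKernel_le_profile_of_one_add_le_hypCosh hx hy hδ ht hxy)
    _ = ∫⁻ b, ENNReal.ofReal (√2 ^ n * Real.exp (-(n / 2) * b) *
          profile 1 (Real.cosh b / 2 + (1 + δ) / 2) t) :=
        lintegral_hypVolume_profile n (α := fun b => Real.cosh b / 2 + (1 + δ) / 2) (by fun_prop)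
          (fun b => by positivity) two_pos ht hy
    _ ≤ ∫⁻ b, ENNReal.ofReal (√2 ^ n * (√(4 * Real.pi * t))⁻¹ * E) *
          ENNReal.ofReal (Real.exp (-(n / 2) * b - b ^ 2 / (4 * (8 * t)))) :=
        lintegral_mono fun b => by
          rw [← ENNReal.ofReal_mul (by positivity), sub_eq_add_neg, Real.exp_add]
          refine ENNReal.ofReal_le_ofReal ((mul_le_mul_of_nonneg_left
            (profile_one_half_cosh_add_le hδ b ht) (by positivity)).trans_eq ?_)
          ring
    _ = _ := by
        rw [lintegral_const_mul' _ _ ENNReal.ofReal_ne_top,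
          lintegral_exp_linear_sub_sq _ (by positivity), ← ENNReal.ofReal_mul (by positivity),
          show 4 * Real.pi * (8 * t) = 8 * (4 * Real.pi * t) by ring,
          Real.sqrt_mul (show (0 : ℝ) ≤ 8 by norm_num),
          show (-(n / 2) : ℝ) ^ 2 * (8 * t) = 2 * n ^ 2 * t by ring, Nat.cast_add_one,
          add_sub_cancel_right, Nat.add_sub_cancel]
        congr 1
        field_simp

end Kernel

/-! ### The hyperbolic Laplacian -/

section LineDeriv

variable {E : Type*} [NormedAddCommGroup E] [NormedSpace ℝ E] {f : E → ℝ} {x v : E}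

lemma hasDerivAt_comp_add_smul {F : Type*} [NormedAddCommGroup F] [NormedSpace ℝ F] {f : E → F}
    {f' : F} {s : ℝ} (h : HasLineDerivAt ℝ f f' (x + s • v) v) :
    HasDerivAt (fun r : ℝ => f (x + r • v)) f' s := by
  rw [HasLineDerivAt, ← sub_self s] at h
  have := h.comp_sub_const s s
  refine this.congr_of_eventuallyEq (Eventually.of_forall fun r => ?_)
  beta_reduce
  rw [add_assoc, ← add_smul, add_sub_cancel]

lemma eq_zero_and_nonneg_of_isLocalMin {D : E → ℝ} {c : ℝ}
    (hf : ∀ᶠ z in 𝓝 x, HasLineDerivAt ℝ f (D z) z v) (hD : HasLineDerivAt ℝ D c x v)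
    (hmin : IsLocalMin f x) : D x = 0 ∧ 0 ≤ c := by
  set g := fun s : ℝ => f (x + s • v)
  have hline : Tendsto (fun s : ℝ => x + s • v) (𝓝 0) (𝓝 x) :=
    Continuous.tendsto' (by fun_prop) _ _ (by simp)
  have hg : ∀ᶠ s in 𝓝 (0 : ℝ), HasDerivAt g (D (x + s • v)) s :=
    (hline.eventually hf).mono fun s hs => hasDerivAt_comp_add_smul hs
  have hgmin : IsLocalMin g 0 := by
    simpa only [g, IsLocalMin, IsMinFilter, zero_smul, add_zero] using hline.eventually hmin
  have hderiv : deriv g =ᶠ[𝓝 0] fun s => D (x + s • v) := hg.mono fun s hs => hs.deriv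
  have hderiv₂ : deriv (deriv g) 0 = c := by rw [hderiv.deriv_eq, hD.deriv]
  have hzero : D x = 0 := by
    simpa using hgmin.hasDerivAt_eq_zero hg.self_of_nhds
  refine ⟨hzero, not_lt.1 fun hc => ?_⟩
  have hgmax : IsLocalMax g 0 := isLocalMax_of_deriv_deriv_neg (by rwa [hderiv₂])
    (by simpa [hderiv.eq_of_nhds] using hzero) hg.self_of_nhds.continuousAt
  have hconst : deriv g =ᶠ[𝓝 0] fun _ => 0 := by
    filter_upwards [(hgmin.and hgmax).eventually_nhds] with s hs
    have : g =ᶠ[𝓝 s] fun _ => g 0 := hs.mono fun r hr => le_antisymm hr.2 hr.1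
    rw [this.deriv_eq, deriv_const]
  rw [← hderiv₂, hconst.deriv_eq, deriv_const] at hc
  exact lt_irrefl _ hc

end LineDeriv

section Laplacian

variable {d : ℕ} [NeZero d] {f g : Coord d → ℝ} {L M : ℝ} {x : Coord d}

/-- `f` has hyperbolic Laplacian `L` at `x`: `D i` is the `i`-th partial derivative of `f` near `x`,
`D₂ i` that of `D i` at `x`, and `L = x₀² ∑ D₂ i + (2 - d) x₀ D 0`. Only derivatives along
coordinate lines are involved, which makes it easy to check and enough for the minimum
principle. -/
def HasLaplacianAt (f : Coord d → ℝ) (L : ℝ) (x : Coord d) : Prop :=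
  ∃ (D : Fin d → Coord d → ℝ) (D₂ : Fin d → ℝ),
    (∀ i, ∀ᶠ z in 𝓝 x, HasLineDerivAt ℝ f (D i z) z (EuclideanSpace.single i 1)) ∧
    (∀ i, HasLineDerivAt ℝ (D i) (D₂ i) x (EuclideanSpace.single i 1)) ∧
    L = x 0 ^ 2 * ∑ i, D₂ i + (2 - d) * x 0 * D 0 x

namespace HasLaplacianAt

lemma sub (hf : HasLaplacianAt f L x) (hg : HasLaplacianAt g M x) :
    HasLaplacianAt (fun z => f z - g z) (L - M) x := by
  obtain ⟨D, D₂, hD, hD₂, rfl⟩ := hf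
  obtain ⟨E, E₂, hE, hE₂, rfl⟩ := hg
  refine ⟨fun i z => D i z - E i z, fun i => D₂ i - E₂ i, fun i => ?_,
    fun i => HasDerivAt.sub (hD₂ i) (hE₂ i), ?_⟩
  · filter_upwards [hD i, hE i] with z hDz hEz using HasDerivAt.sub hDz hEz
  · rw [Finset.sum_sub_distrib]
    ring

lemma add_const (hf : HasLaplacianAt f L x) (c : ℝ) : HasLaplacianAt (fun z => f z + c) L x := by
  obtain ⟨D, D₂, hD, hD₂, hL⟩ := hf
  exact ⟨D, D₂, fun i => (hD i).mono fun z hz => HasDerivAt.add_const c hz, hD₂, hL⟩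

lemma congr_of_eventuallyEq (hf : HasLaplacianAt f L x) (h : g =ᶠ[𝓝 x] f) :
    HasLaplacianAt g L x := by
  obtain ⟨D, D₂, hD, hD₂, hL⟩ := hf
  refine ⟨D, D₂, fun i => ?_, hD₂, hL⟩
  filter_upwards [hD i, h.eventuallyEq_nhds] with z hDz hz using hDz.congr_of_eventuallyEq hz

lemma unique (hf : HasLaplacianAt f L x) (hf' : HasLaplacianAt f M x) : L = M := by
  obtain ⟨D, D₂, hD, hD₂, rfl⟩ := hf
  obtain ⟨E, E₂, hE, hE₂, rfl⟩ := hf'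
  have hDE (i : Fin d) : D i =ᶠ[𝓝 x] E i := by
    filter_upwards [hD i, hE i] with z hDz hEz using hDz.unique hEz
  have hDE₂ (i : Fin d) : D₂ i = E₂ i :=
    (hD₂ i).unique ((hE₂ i).congr_of_eventuallyEq (hDE i))
  simp only [hDE₂, (hDE 0).eq_of_nhds]

lemma nonneg_of_isLocalMin (hf : HasLaplacianAt f L x) (hmin : IsLocalMin f x) : 0 ≤ L := by
  obtain ⟨D, D₂, hD, hD₂, rfl⟩ := hf
  have h (i : Fin d) := eq_zero_and_nonneg_of_isLocalMin (hD i) (hD₂ i) hmin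
  rw [(h 0).1, mul_zero, add_zero]
  exact mul_nonneg (sq_nonneg _) (Finset.sum_nonneg fun i _ => (h i).2)

end HasLaplacianAt

lemma contDiffOn_partialDeriv (hf : ContDiffOn ℝ 2 f (hypSpace d)) (i : Fin d) :
    ContDiffOn ℝ 1 (partialDeriv i f) (hypSpace d) :=
  (hf.fderiv_of_isOpen isOpen_hypSpace (by norm_num)).clm_apply contDiffOn_const

lemma hasFDerivAt_of_contDiffOn_hypSpace {n : WithTop ℕ∞} (hn : n ≠ 0)
    (hf : ContDiffOn ℝ n f (hypSpace d)) (hx : x ∈ hypSpace d) : HasFDerivAt f (fderiv ℝ f x) x :=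
  ((hf.contDiffAt (isOpen_hypSpace.mem_nhds hx)).differentiableAt hn).hasFDerivAt

lemma inv_hypMetric (hx : x ∈ hypSpace d) :
    (hypMetric d x)⁻¹ = Matrix.diagonal fun _ => x 0 ^ 2 := by
  have hx0 : x 0 ≠ 0 := ne_of_gt hx
  refine Matrix.inv_eq_left_inv ?_
  rw [hypMetric, Matrix.diagonal_mul_diagonal, ← Matrix.diagonal_one]
  congr 1
  ext
  field_simp

lemma volumeDensity_mul_inv_hypMetric_partialDeriv (hx : x ∈ hypSpace d) (i : Fin d) :
    ∑ j, volumeDensity (hypMetric d) x * (hypMetric d x)⁻¹ i j * partialDeriv j f x =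
      x 0 ^ (2 - d : ℤ) * partialDeriv i f x := by
  have hx0 : x 0 ≠ 0 := ne_of_gt hx
  simp only [inv_hypMetric hx, Matrix.diagonal_apply, mul_ite, mul_zero, ite_mul, zero_mul,
    Finset.sum_ite_eq, Finset.mem_univ, if_true, volumeDensity_hypMetric hx]
  rw [zpow_sub₀ hx0, zpow_natCast, zpow_ofNat, div_eq_inv_mul]

lemma partialDeriv_zpow_mul (hx : x 0 ≠ 0) (m : ℤ) (hf : DifferentiableAt ℝ f x) (i : Fin d) :
    partialDeriv i (fun z => z 0 ^ m * f z) x = x 0 ^ m * partialDeriv i f x +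
      f x * (m * x 0 ^ (m - 1) * (EuclideanSpace.single i (1 : ℝ) : Coord d) 0) := by
  have hcoord : HasFDerivAt (fun z : Coord d => z 0) (EuclideanSpace.proj (𝕜 := ℝ) 0) x :=
    (EuclideanSpace.proj (𝕜 := ℝ) (0 : Fin d)).hasFDerivAt
  have hpow := (hasDerivAt_zpow m (x 0) (Or.inl hx)).comp_hasFDerivAt x hcoord
  have hmul : HasFDerivAt (fun z => z 0 ^ m * f z) _ x := hpow.mul hf.hasFDerivAt
  rw [partialDeriv, hmul.fderiv]
  simp [partialDeriv]

lemma laplaceBeltrami_hypMetric (hf : ContDiffOn ℝ 2 f (hypSpace d)) (hx : x ∈ hypSpace d) :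
    laplaceBeltrami (hypMetric d) f x =
      x 0 ^ 2 * ∑ i, partialDeriv i (partialDeriv i f) x + (2 - d) * x 0 * partialDeriv 0 f x := by
  have hx0 : x 0 ≠ 0 := ne_of_gt hx
  have hflux (i : Fin d) : partialDeriv i (fun z => ∑ j, volumeDensity (hypMetric d) z *
      (hypMetric d z)⁻¹ i j * partialDeriv j f z) x =
      partialDeriv i (fun z => z 0 ^ (2 - d : ℤ) * partialDeriv i f z) x := by
    have heq : (fun z => ∑ j, volumeDensity (hypMetric d) z * (hypMetric d z)⁻¹ i j *
        partialDeriv j f z) =ᶠ[𝓝 x] fun z => z 0 ^ (2 - d : ℤ) * partialDeriv i f z :=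
      eventually_of_mem (isOpen_hypSpace.mem_nhds hx) fun z hz =>
        volumeDensity_mul_inv_hypMetric_partialDeriv hz i
    rw [partialDeriv, heq.fderiv_eq, partialDeriv]
  have hdiff (i : Fin d) : DifferentiableAt ℝ (partialDeriv i f) x :=
    (hasFDerivAt_of_contDiffOn_hypSpace one_ne_zero (contDiffOn_partialDeriv hf i)
      hx).differentiableAt
  simp only [laplaceBeltrami, hflux, partialDeriv_zpow_mul hx0 _ (hdiff _),
    volumeDensity_hypMetric hx, Finset.sum_add_distrib, ← Finset.mul_sum,
    PiLp.single_apply, mul_ite, mul_one, mul_zero, Finset.sum_ite_eq, Finset.mem_univ,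
    if_true]
  rw [zpow_sub_one₀ hx0, zpow_sub₀ hx0, zpow_natCast, zpow_ofNat]
  push_cast
  field_simp

lemma hasLaplacianAt_laplaceBeltrami (hf : ContDiffOn ℝ 2 f (hypSpace d)) (hx : x ∈ hypSpace d) :
    HasLaplacianAt f (laplaceBeltrami (hypMetric d) f x) x := by
  refine ⟨fun i => partialDeriv i f, fun i => partialDeriv i (partialDeriv i f) x, fun i => ?_,
    fun i => ?_, laplaceBeltrami_hypMetric hf hx⟩
  · filter_upwards [isOpen_hypSpace.mem_nhds hx] with z hz
    exact (hasFDerivAt_of_contDiffOn_hypSpace two_ne_zero hf hz).hasLineDerivAt _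
  · exact (hasFDerivAt_of_contDiffOn_hypSpace one_ne_zero (contDiffOn_partialDeriv hf i)
      hx).hasLineDerivAt _

end Laplacian

/-! ### The heat equation for the kernel -/

section HeatEquation

variable {d : ℕ} [NeZero d] {x y v : Coord d} {t : ℝ}

/-- The derivative of `hypCosh x y` in `x` along the vector `v`. -/
def hypCoshDeriv (v x y : Coord d) : ℝ :=
  inner ℝ (x - y) v / (x 0 * y 0) - v 0 * dist x y ^ 2 / (2 * (x 0 ^ 2 * y 0))

/-- The second derivative of `hypCosh x y` in `x` along the vector `v`. -/
def hypCoshDeriv₂ (v x y : Coord d) : ℝ :=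
  ‖v‖ ^ 2 / (x 0 * y 0) - 2 * v 0 * inner ℝ (x - y) v / (x 0 ^ 2 * y 0) +
    v 0 ^ 2 * dist x y ^ 2 / (x 0 ^ 3 * y 0)

omit [NeZero d] in
lemma hasLineDerivAt_dist_sq (v x y : Coord d) :
    HasLineDerivAt ℝ (fun x => dist x y ^ 2) (2 * inner ℝ (x - y) v) x v := by
  simp only [dist_eq_norm]
  have h := ((hasFDerivAt_id x).sub_const y).norm_sq.hasLineDerivAt v
  exact h.congr_deriv (by simp [two_mul, inner_sub_left])

lemma hasLineDerivAt_coord (v x : Coord d) : HasLineDerivAt ℝ (fun x => x 0) (v 0) x v :=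
  (EuclideanSpace.proj (𝕜 := ℝ) (0 : Fin d)).hasFDerivAt.hasLineDerivAt v

omit [NeZero d] in
lemma hasLineDerivAt_inner_sub (v x y : Coord d) :
    HasLineDerivAt ℝ (fun x => inner ℝ (x - y) v) (‖v‖ ^ 2) x v := by
  rw [← real_inner_self_eq_norm_sq]
  simpa using (((hasFDerivAt_id x).sub_const y).inner ℝ (hasFDerivAt_const v x)).hasLineDerivAt v

lemma hasLineDerivAt_hypCosh (v : Coord d) (hx : x ∈ hypSpace d) (hy : y ∈ hypSpace d) :
    HasLineDerivAt ℝ (hypCosh · y) (hypCoshDeriv v x y) x v := by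
  have hx0 : x 0 ≠ 0 := ne_of_gt hx
  have hy0 : y 0 ≠ 0 := ne_of_gt hy
  have hnum : HasDerivAt _ _ _ := hasLineDerivAt_dist_sq v x y
  have hden : HasDerivAt _ _ _ := hasLineDerivAt_coord v x
  refine ((hnum.div ((hden.mul_const (y 0)).const_mul 2)
    (by simp [hx0, hy0])).const_add 1).congr_deriv ?_
  simp only [zero_smul, add_zero, hypCoshDeriv]
  field_simp

lemma hasLineDerivAt_hypCoshDeriv (v : Coord d) (hx : x ∈ hypSpace d) (hy : y ∈ hypSpace d) :
    HasLineDerivAt ℝ (hypCoshDeriv v · y) (hypCoshDeriv₂ v x y) x v := by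
  have hx0 : x 0 ≠ 0 := ne_of_gt hx
  have hy0 : y 0 ≠ 0 := ne_of_gt hy
  have hinner : HasDerivAt _ _ _ := hasLineDerivAt_inner_sub v x y
  have hdist : HasDerivAt _ _ _ := hasLineDerivAt_dist_sq v x y
  have hcoord : HasDerivAt _ _ _ := hasLineDerivAt_coord v x
  refine ((hinner.div (hcoord.mul_const (y 0)) (by simp [hx0, hy0])).sub
    ((hdist.const_mul (v 0)).div (((hcoord.pow 2).mul_const (y 0)).const_mul 2)
      (by simp [hx0, hy0]))).congr_deriv ?_
  simp only [zero_smul, add_zero, hypCoshDeriv₂, Pi.pow_apply]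
  field_simp
  ring

/-- `|∇ cosh ρ|² = sinh² ρ` in the hyperbolic metric. -/
lemma sum_hypCoshDeriv_sq (hx : x ∈ hypSpace d) (hy : y ∈ hypSpace d) :
    x 0 ^ 2 * ∑ i, hypCoshDeriv (EuclideanSpace.single i 1) x y ^ 2 = hypCosh x y ^ 2 - 1 := by
  have hx0 : x 0 ≠ 0 := ne_of_gt hx
  have hy0 : y 0 ≠ 0 := ne_of_gt hy
  set k := dist x y ^ 2 / (2 * (x 0 ^ 2 * y 0)) with hk
  have hterm (i : Fin d) : hypCoshDeriv (EuclideanSpace.single i 1) x y ^ 2 =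
      dist (x i) (y i) ^ 2 / (x 0 * y 0) ^ 2 +
        if i = 0 then k ^ 2 - 2 * k * ((x 0 - y 0) / (x 0 * y 0)) else 0 := by
    rcases eq_or_ne i 0 with rfl | hi
    · simp [hypCoshDeriv, EuclideanSpace.inner_single_right, Real.dist_eq, hk]
      ring
    · simp [hypCoshDeriv, EuclideanSpace.inner_single_right, Real.dist_eq, hi, hi.symm, div_pow]
  simp only [hterm, Finset.sum_add_distrib, ← Finset.sum_div, ← EuclideanSpace.dist_sq_eq,
    Finset.sum_ite_eq', Finset.mem_univ, if_true, hypCosh, hk]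
  field_simp
  ring

/-- `Δ cosh ρ = d cosh ρ`. -/
lemma sum_hypCoshDeriv₂ (hx : x ∈ hypSpace d) (hy : y ∈ hypSpace d) :
    x 0 ^ 2 * ∑ i, hypCoshDeriv₂ (EuclideanSpace.single i 1) x y +
      (2 - d) * x 0 * hypCoshDeriv (EuclideanSpace.single 0 1) x y = d * hypCosh x y := by
  have hx0 : x 0 ≠ 0 := ne_of_gt hx
  have hy0 : y 0 ≠ 0 := ne_of_gt hy
  set k := dist x y ^ 2 / (x 0 ^ 3 * y 0) - 2 * (x 0 - y 0) / (x 0 ^ 2 * y 0) with hk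
  have hterm (i : Fin d) : hypCoshDeriv₂ (EuclideanSpace.single i 1) x y =
      1 / (x 0 * y 0) + if i = 0 then k else 0 := by
    rcases eq_or_ne i 0 with rfl | hi
    · simp [hypCoshDeriv₂, EuclideanSpace.inner_single_right, hk]
      ring
    · simp [hypCoshDeriv₂, hi, hi.symm]
  simp only [hterm, Finset.sum_add_distrib, Finset.sum_const, Finset.card_univ, Fintype.card_fin,
    nsmul_eq_mul, Finset.sum_ite_eq', Finset.mem_univ, if_true, hypCosh, hypCoshDeriv, hk,
    EuclideanSpace.inner_single_right, PiLp.single_apply, PiLp.sub_apply, RCLike.conj_to_real]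
  field_simp
  ring

/-- The derivative of `hypKernel x y t` in `x` along the vector `v`. -/
def hypKernelDeriv (v x y : Coord d) (t : ℝ) : ℝ :=
  Real.exp (-((d - 1) / 2) ^ 2 * t) *
    -(2 * Real.pi * profile (d + 2) (hypCosh x y) t * hypCoshDeriv v x y)

/-- The second derivative of `hypKernel x y t` in `x` along the vector `v`. -/
def hypKernelDeriv₂ (v x y : Coord d) (t : ℝ) : ℝ :=
  Real.exp (-((d - 1) / 2) ^ 2 * t) *
    ((2 * Real.pi) ^ 2 * profile (d + 4) (hypCosh x y) t * hypCoshDeriv v x y ^ 2 -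
      2 * Real.pi * profile (d + 2) (hypCosh x y) t * hypCoshDeriv₂ v x y)

/-- The derivative of `hypKernel x y t` in `t`. -/
def hypKernelTimeDeriv (x y : Coord d) (t : ℝ) : ℝ :=
  Real.exp (-((d - 1) / 2) ^ 2 * t) *
    ((hypCosh x y ^ 2 - 1) * ((2 * Real.pi) ^ 2 * profile (d + 4) (hypCosh x y) t) -
      d * hypCosh x y * (2 * Real.pi * profile (d + 2) (hypCosh x y) t))

lemma hasLineDerivAt_profile_hypCosh (k : ℕ) (v : Coord d) (hx : x ∈ hypSpace d)
    (hy : y ∈ hypSpace d) (ht : 0 < t) :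
    HasLineDerivAt ℝ (fun x => profile k (hypCosh x y) t)
      (-(2 * Real.pi * profile (k + 2) (hypCosh x y) t) * hypCoshDeriv v x y) x v := by
  have h := hasDerivAt_profile k (hypCosh_pos hx hy) ht
  exact HasDerivAt.comp_of_eq (0 : ℝ) h (hasLineDerivAt_hypCosh v hx hy) (by simp)

lemma hasLineDerivAt_hypKernel (v : Coord d) (hx : x ∈ hypSpace d) (hy : y ∈ hypSpace d)
    (ht : 0 < t) : HasLineDerivAt ℝ (hypKernel · y t) (hypKernelDeriv v x y t) x v := by
  refine (HasDerivAt.const_mul _ (hasLineDerivAt_profile_hypCosh d v hx hy ht)).congr_deriv ?_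
  simp only [hypKernelDeriv, neg_mul]

lemma hasLineDerivAt_hypKernelDeriv (v : Coord d) (hx : x ∈ hypSpace d) (hy : y ∈ hypSpace d)
    (ht : 0 < t) : HasLineDerivAt ℝ (hypKernelDeriv v · y t) (hypKernelDeriv₂ v x y t) x v := by
  have hprofile : HasDerivAt _ _ _ := hasLineDerivAt_profile_hypCosh (d + 2) v hx hy ht
  have hcosh : HasDerivAt _ _ _ := hasLineDerivAt_hypCoshDeriv v hx hy
  refine ((((hprofile.const_mul (2 * Real.pi)).mul hcosh).neg).const_mul _).congr_deriv ?_
  simp only [hypKernelDeriv₂, zero_smul, add_zero]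
  ring

lemma sum_hypKernelDeriv₂ (hx : x ∈ hypSpace d) (hy : y ∈ hypSpace d) (t : ℝ) :
    x 0 ^ 2 * ∑ i, hypKernelDeriv₂ (EuclideanSpace.single i 1) x y t +
      (2 - d) * x 0 * hypKernelDeriv (EuclideanSpace.single 0 1) x y t =
      hypKernelTimeDeriv x y t := by
  simp only [hypKernelDeriv₂, hypKernelDeriv, hypKernelTimeDeriv, ← Finset.mul_sum,
    Finset.sum_sub_distrib, ← sum_hypCoshDeriv_sq hx hy, ← sum_hypCoshDeriv₂ hx hy]
  ring

lemma hasDerivAt_hypKernel_time (hx : x ∈ hypSpace d) (hy : y ∈ hypSpace d) (ht : 0 < t) :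
    HasDerivAt (hypKernel x y) (hypKernelTimeDeriv x y t) t := by
  have hexp := ((hasDerivAt_id t).const_mul (-(((d : ℝ) - 1) / 2) ^ 2)).exp
  refine (hexp.mul (hasDerivAt_profile_time d (hypCosh_pos hx hy) ht)).congr_deriv ?_
  simp only [hypKernelTimeDeriv, radialHeatOp, id]
  ring

lemma hasLaplacianAt_hypKernel (hx : x ∈ hypSpace d) (hy : y ∈ hypSpace d) (ht : 0 < t) :
    HasLaplacianAt (hypKernel · y t) (hypKernelTimeDeriv x y t) x := by
  refine ⟨fun i z => hypKernelDeriv (EuclideanSpace.single i 1) z y t,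
    fun i => hypKernelDeriv₂ (EuclideanSpace.single i 1) x y t, fun i => ?_,
    fun i => hasLineDerivAt_hypKernelDeriv _ hx hy ht, (sum_hypKernelDeriv₂ hx hy t).symm⟩
  filter_upwards [isOpen_hypSpace.mem_nhds hx] with z hz using hasLineDerivAt_hypKernel _ hz hy ht

lemma continuousOn_hypCoshDeriv (v : Coord d) :
    ContinuousOn ↿(hypCoshDeriv v) (hypSpace d ×ˢ hypSpace d) := by
  have hne : ∀ q ∈ hypSpace d ×ˢ hypSpace d, q.1 0 ≠ 0 ∧ q.2 0 ≠ 0 :=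
    fun q hq => ⟨ne_of_gt hq.1, ne_of_gt hq.2⟩
  refine .sub (.div (by fun_prop) (by fun_prop) fun q hq => ?_)
    (.div (by fun_prop) (by fun_prop) fun q hq => ?_) <;>
  simp [hne q hq]

lemma continuousOn_hypCoshDeriv₂ (v : Coord d) :
    ContinuousOn ↿(hypCoshDeriv₂ v) (hypSpace d ×ˢ hypSpace d) := by
  have hne : ∀ q ∈ hypSpace d ×ˢ hypSpace d, q.1 0 ≠ 0 ∧ q.2 0 ≠ 0 :=
    fun q hq => ⟨ne_of_gt hq.1, ne_of_gt hq.2⟩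
  refine .add (.sub (.div (by fun_prop) (by fun_prop) fun q hq => ?_)
    (.div (by fun_prop) (by fun_prop) fun q hq => ?_))
    (.div (by fun_prop) (by fun_prop) fun q hq => ?_) <;>
  simp [hne q hq]

/-- The triples `(x, y, t)` at which the heat kernel is considered. -/
abbrev kernelDomain (d : ℕ) [NeZero d] : Set (Coord d × Coord d × ℝ) :=
  hypSpace d ×ˢ hypSpace d ×ˢ Ioi 0

lemma continuousOn_kernelDomain {f : Coord d → Coord d → ℝ}
    (hf : ContinuousOn ↿f (hypSpace d ×ˢ hypSpace d)) :
    ContinuousOn (fun q : Coord d × Coord d × ℝ => f q.1 q.2.1) (kernelDomain d) :=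
  hf.comp (f := fun q : Coord d × Coord d × ℝ => (q.1, q.2.1)) (by fun_prop)
    fun _ hq => ⟨hq.1, hq.2.1⟩

lemma continuousOn_profile_hypCosh (k : ℕ) :
    ContinuousOn (fun q : Coord d × Coord d × ℝ => profile k (hypCosh q.1 q.2.1) q.2.2)
      (kernelDomain d) :=
  (continuousOn_profile k).comp
    (f := fun q : Coord d × Coord d × ℝ => (hypCosh q.1 q.2.1, q.2.2))
    ((continuousOn_kernelDomain continuousOn_hypCosh).prodMk (by fun_prop))
    fun _ hq => ⟨hypCosh_pos hq.1 hq.2.1, hq.2.2⟩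

lemma continuousOn_hypKernel : ContinuousOn ↿(hypKernel (d := d)) (kernelDomain d) :=
  .mul (by fun_prop) (continuousOn_profile_hypCosh d)

lemma continuousOn_hypKernelDeriv (v : Coord d) :
    ContinuousOn ↿(hypKernelDeriv v) (kernelDomain d) :=
  .mul (by fun_prop) (((continuousOn_profile_hypCosh (d + 2)).const_mul _).mul
    (continuousOn_kernelDomain (continuousOn_hypCoshDeriv v))).neg

lemma continuousOn_hypKernelDeriv₂ (v : Coord d) :
    ContinuousOn ↿(hypKernelDeriv₂ v) (kernelDomain d) :=
  .mul (by fun_prop) ((((continuousOn_profile_hypCosh (d + 4)).const_mul _).mul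
    ((continuousOn_kernelDomain (continuousOn_hypCoshDeriv v)).pow 2)).sub
    (((continuousOn_profile_hypCosh (d + 2)).const_mul _).mul
      (continuousOn_kernelDomain (continuousOn_hypCoshDeriv₂ v))))

lemma continuousOn_hypKernelTimeDeriv :
    ContinuousOn ↿(hypKernelTimeDeriv (d := d)) (kernelDomain d) := by
  have hcosh := continuousOn_kernelDomain (continuousOn_hypCosh (d := d))
  exact .mul (by fun_prop) ((((hcosh.pow 2).sub continuousOn_const).mul
    ((continuousOn_profile_hypCosh (d + 4)).const_mul _)).sub
    ((hcosh.const_mul _).mul ((continuousOn_profile_hypCosh (d + 2)).const_mul _)))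

lemma contDiffOn_profile (k : ℕ) (ht : 0 < t) (N : ℕ) :
    ContDiffOn ℝ N (profile k · t) (Ioi 0) := by
  induction N generalizing k with
  | zero =>
    exact contDiffOn_zero.2 fun u hu =>
      (hasDerivAt_profile k hu ht).continuousAt.continuousWithinAt
  | succ N ih =>
    push_cast
    refine (contDiffOn_succ_iff_deriv_of_isOpen isOpen_Ioi).2 ⟨fun u hu =>
      (hasDerivAt_profile k hu ht).differentiableAt.differentiableWithinAt, by simp, ?_⟩
    exact (contDiffOn_const.mul (ih (k + 2))).neg.congr fun u hu =>
      (hasDerivAt_profile k hu ht).deriv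

lemma contDiffOn_hypKernel (hy : y ∈ hypSpace d) (ht : 0 < t) :
    ContDiffOn ℝ 2 (hypKernel · y t) (hypSpace d) := by
  have hcosh : ContDiffOn ℝ 2 (hypCosh · y) (hypSpace d) := by
    simp only [hypCosh, dist_eq_norm]
    refine contDiffOn_const.add (.div ?_ (by fun_prop) fun x hx => ?_)
    · exact ((contDiff_id.sub contDiff_const).norm_sq ℝ).contDiffOn
    · have : 0 < x 0 := hx
      have : 0 < y 0 := hy
      positivity
  exact contDiffOn_const.mul ((contDiffOn_profile d ht 2).comp hcosh fun x hx => hypCosh_pos hx hy)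

lemma contDiffOn_hypKernel_time (hx : x ∈ hypSpace d) (hy : y ∈ hypSpace d) :
    ContDiffOn ℝ 1 (hypKernel x y) (Ioi 0) := by
  rw [← zero_add (1 : WithTop ℕ∞)]
  refine (contDiffOn_succ_iff_deriv_of_isOpen isOpen_Ioi).2 ⟨fun t ht =>
    (hasDerivAt_hypKernel_time hx hy ht).differentiableAt.differentiableWithinAt, by simp, ?_⟩
  have hcont : ContinuousOn (hypKernelTimeDeriv x y) (Ioi 0) :=
    continuousOn_hypKernelTimeDeriv.comp (f := fun t : ℝ => (x, y, t)) (by fun_prop)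
      fun t ht => ⟨hx, hy, ht⟩
  exact contDiffOn_zero.2 (hcont.congr fun t ht => (hasDerivAt_hypKernel_time hx hy ht).deriv)

lemma aestronglyMeasurable_hypVolume {f : Coord d → ℝ} (hf : ContinuousOn f (hypSpace d)) :
    AEStronglyMeasurable f (hypVolume d) :=
  (hf.aestronglyMeasurable measurableSet_hypSpace).mono_ac (withDensity_absolutelyContinuous _ _)

lemma hypVolume_ne_top {K : Set (Coord d)} (hK : IsCompact K) (hKH : K ⊆ hypSpace d) :
    hypVolume d K ≠ ⊤ := by
  have hdensity : ContinuousOn (volumeDensity (hypMetric d)) K := by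
    refine ContinuousOn.congr (f := fun x => (x 0 ^ d)⁻¹)
      (ContinuousOn.inv₀ (by fun_prop) fun x hx => ?_) fun x hx => volumeDensity_hypMetric (hKH hx)
    have : 0 < x 0 := hKH hx
    positivity
  rw [hypVolume, withDensity_apply _ hK.measurableSet, Measure.restrict_restrict hK.measurableSet,
    inter_eq_self_of_subset_left hKH]
  exact (hdensity.integrableOn_compact hK).lintegral_lt_top.ne

lemma continuousOn_hypKernel_left (hy : y ∈ hypSpace d) (ht : 0 < t) :
    ContinuousOn (hypKernel · y t) (hypSpace d) :=
  continuousOn_hypKernel.comp (f := fun x => (x, y, t)) (by fun_prop) fun _ hx => ⟨hx, hy, ht⟩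

lemma ae_hypKernel_nonneg (hy : y ∈ hypSpace d) (ht : 0 < t) :
    0 ≤ᵐ[hypVolume d] fun x => hypKernel x y t := by
  filter_upwards [ae_mem_hypSpace] with x hx using (hypKernel_pos hx hy ht).le

lemma integrable_hypKernel (hy : y ∈ hypSpace d) (ht : 0 < t) :
    Integrable (hypKernel · y t) (hypVolume d) := by
  refine ⟨aestronglyMeasurable_hypVolume (continuousOn_hypKernel_left hy ht), ?_⟩
  rw [hasFiniteIntegral_iff_ofReal (ae_hypKernel_nonneg hy ht), lintegral_hypKernel hy ht]
  exact ENNReal.one_lt_top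

lemma integral_hypKernel (hy : y ∈ hypSpace d) (ht : 0 < t) :
    ∫ x, hypKernel x y t ∂hypVolume d = 1 := by
  rw [integral_eq_lintegral_of_nonneg_ae (ae_hypKernel_nonneg hy ht)
    (integrable_hypKernel hy ht).aestronglyMeasurable, lintegral_hypKernel hy ht,
    ENNReal.toReal_one]

end HeatEquation

/-! ### Convergence to the Dirac mass -/

section HypCosh

variable {d : ℕ} [NeZero d] {x y : Coord d} {t : ℝ}

lemma coord_zero_le_mul_hypCosh (hx : x ∈ hypSpace d) (hy : y ∈ hypSpace d) :
    x 0 ≤ 2 * hypCosh x y * y 0 := by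
  have hx0 : 0 < x 0 := hx
  have hy0 : 0 < y 0 := hy
  have hcoord : |x 0 - y 0| ≤ dist x y := by
    rw [dist_eq_norm]
    exact PiLp.norm_apply_le (x - y) 0
  have hsq : (x 0 - y 0) ^ 2 ≤ dist x y ^ 2 := sq_le_sq' (abs_le.1 hcoord).1 (abs_le.1 hcoord).2
  refine le_of_mul_le_mul_left (a := x 0) ?_ hx0
  calc x 0 * x 0 ≤ 2 * (x 0 * y 0) + dist x y ^ 2 := by nlinarith [sq_nonneg (y 0)]
    _ = x 0 * (2 * hypCosh x y * y 0) := by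
      rw [hypCosh]
      field_simp

lemma dist_le_mul_hypCosh (hx : x ∈ hypSpace d) (hy : y ∈ hypSpace d) :
    dist x y ≤ 2 * hypCosh x y * y 0 := by
  have hx0 : 0 < x 0 := hx
  have hy0 : 0 < y 0 := hy
  have hU := hypCosh_pos hx hy
  refine le_of_sq_le_sq ?_ (by positivity)
  calc dist x y ^ 2 = 2 * (hypCosh x y - 1) * y 0 * x 0 := by
        rw [hypCosh]
        field_simp
        ring
    _ ≤ 2 * hypCosh x y * y 0 * x 0 := by gcongr; linarith
    _ ≤ 2 * hypCosh x y * y 0 * (2 * hypCosh x y * y 0) := by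
        gcongr
        exact coord_zero_le_mul_hypCosh hx hy
    _ = (2 * hypCosh x y * y 0) ^ 2 := by ring

lemma exists_isCompact_lt_hypCosh {K : Set (Coord d)} (hK : IsCompact K) (hKH : K ⊆ hypSpace d)
    {m : ℝ} (hm : 0 < m) :
    ∃ C ⊆ hypSpace d, IsCompact C ∧ ∀ x ∈ hypSpace d \ C, ∀ y ∈ K, m < hypCosh x y := by
  rcases K.eq_empty_or_nonempty with rfl | hne
  · exact ⟨∅, by simp, isCompact_empty, by simp⟩
  have hcoord : ContinuousOn (fun y : Coord d => y 0) K := by fun_prop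
  obtain ⟨a, haK, ha⟩ := hK.exists_isMinOn hne hcoord
  obtain ⟨b, _, hb⟩ := hK.exists_isMaxOn hne hcoord
  have ha0 : 0 < a 0 := hKH haK
  have hlow : 0 < a 0 / (2 * m) := by positivity
  refine ⟨{x : Coord d | a 0 / (2 * m) ≤ x 0} ∩ Metric.cthickening (2 * m * b 0) K,
    fun x hx => hlow.trans_le hx.1,
    hK.cthickening.inter_left (isClosed_le continuous_const (by fun_prop)), ?_⟩
  intro x ⟨hx, hxC⟩ y hy
  contrapose! hxC with hU
  have hx0 : 0 < x 0 := hx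
  have hy0 : 0 < y 0 := hKH hy
  constructor
  · refine (div_le_iff₀' (mul_pos two_pos hm)).2 ?_
    calc a 0 ≤ y 0 := ha hy
      _ ≤ 2 * hypCosh x y * x 0 := hypCosh_comm y x ▸ coord_zero_le_mul_hypCosh (hKH hy) hx
      _ ≤ 2 * m * x 0 := by gcongr
  · refine Metric.mem_cthickening_of_dist_le x y _ K hy ?_
    calc dist x y ≤ 2 * hypCosh x y * y 0 := dist_le_mul_hypCosh hx (hKH hy)
      _ ≤ 2 * m * b 0 := by gcongr; exact hb hy

lemma exists_forall_dist_lt_of_hypCosh_lt {K : Set (Coord d)} (hK : IsCompact K)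
    (hKH : K ⊆ hypSpace d) {r : ℝ} (hr : 0 < r) :
    ∃ δ > 0, ∀ x ∈ hypSpace d, ∀ y ∈ K, hypCosh x y < 1 + δ → dist x y < r := by
  obtain ⟨b, hb⟩ := hK.exists_bound_of_continuousOn (f := fun y : Coord d => y 0) (by fun_prop)
  refine ⟨min 1 (r ^ 2 / (8 * (b ^ 2 + 1))), by positivity, fun x hx y hy hxy => ?_⟩
  have hy0 : 0 < y 0 := hKH hy
  obtain ⟨hlt_two, hlt⟩ : hypCosh x y < 1 + 1 ∧ hypCosh x y < 1 + r ^ 2 / (8 * (b ^ 2 + 1)) := by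
    rwa [← min_add_add_left, lt_min_iff] at hxy
  have hyb : y 0 ≤ b := (le_abs_self _).trans (hb y hy)
  have hx4 : x 0 ≤ 4 * y 0 := (coord_zero_le_mul_hypCosh hx (hKH hy)).trans (by gcongr; linarith)
  refine lt_of_pow_lt_pow_left₀ 2 hr.le ?_
  calc dist x y ^ 2 = (hypCosh x y - 1) * (2 * (x 0 * y 0)) := by
        have hx0 : 0 < x 0 := hx
        rw [hypCosh]
        field_simp
        ring
    _ ≤ (hypCosh x y - 1) * (8 * b ^ 2) :=
        mul_le_mul_of_nonneg_left (by nlinarith) (sub_nonneg.2 (one_le_hypCosh hx (hKH hy)))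
    _ < r ^ 2 / (8 * (b ^ 2 + 1)) * (8 * (b ^ 2 + 1)) :=
        mul_lt_mul' (by linarith) (by linarith) (by positivity) (by positivity)
    _ = r ^ 2 := div_mul_cancel₀ _ (by positivity)

end HypCosh

section Dirac

variable {d : ℕ} [NeZero d] {x y : Coord d} {t : ℝ} {g : Coord d → ℝ}

lemma eventually_integral_hypKernel_far_le {δ η : ℝ} (hδ : 0 < δ) (hη : 0 < η) :
    ∀ᶠ t in 𝓝[>] (0 : ℝ), ∀ y ∈ hypSpace d,
      ∫ x in {x | 1 + δ ≤ hypCosh x y}, hypKernel x y t ∂hypVolume d ≤ η := by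
  have hrate : 0 < Real.arcosh (1 + δ / 2) ^ 2 / 8 := by
    have : 0 < Real.arcosh (1 + δ / 2) := Real.arcosh_pos (by linarith)
    positivity
  have hpre : Tendsto (fun t : ℝ => √2 ^ (d - 1) * √8 * Real.exp (2 * (d - 1) ^ 2 * t)) (𝓝[>] 0)
      (𝓝 (√2 ^ (d - 1) * √8 * Real.exp (2 * (d - 1) ^ 2 * 0))) :=
    (Continuous.tendsto (by fun_prop) 0).mono_left nhdsWithin_le_nhds
  have hexp : Tendsto (fun t : ℝ => Real.exp (-(Real.arcosh (1 + δ / 2) ^ 2 / 8) * t⁻¹)) (𝓝[>] 0)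
      (𝓝 0) :=
    Real.tendsto_exp_atBot.comp
      (tendsto_inv_nhdsGT_zero.const_mul_atTop_of_neg (neg_neg_of_pos hrate))
  have hlim := hpre.mul hexp
  rw [mul_zero] at hlim
  filter_upwards [hlim.eventually_lt_const hη, self_mem_nhdsWithin] with t htη ht y hy
  rw [integral_eq_lintegral_of_nonneg_ae (ae_restrict_of_ae (ae_hypKernel_nonneg hy ht))
    (integrable_hypKernel hy ht).aestronglyMeasurable.restrict]
  exact (ENNReal.toReal_le_of_le_ofReal (by positivity)
    (lintegral_hypKernel_far_le hδ hy ht)).trans htη.le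

lemma exists_forall_abs_sub_le_of_hypCosh_lt (hg : Continuous g) (hgc : HasCompactSupport g)
    (hgs : tsupport g ⊆ hypSpace d) {η : ℝ} (hη : 0 < η) :
    ∃ δ > 0, ∀ x ∈ hypSpace d, ∀ y ∈ hypSpace d, hypCosh x y < 1 + δ → |g x - g y| ≤ η := by
  obtain ⟨r, hr, hgr⟩ := Metric.uniformContinuous_iff.1
    (hgc.uniformContinuous_of_continuous hg) η hη
  obtain ⟨δ, hδ, hdist⟩ := exists_forall_dist_lt_of_hypCosh_lt hgc.isCompact hgs hr
  refine ⟨δ, hδ, fun x hx y hy hxy => ?_⟩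
  rw [← Real.dist_eq]
  by_cases hyg : y ∈ tsupport g
  · exact (hgr (hdist x hx y hyg hxy)).le
  by_cases hxg : x ∈ tsupport g
  · rw [dist_comm]
    exact (hgr (hdist y hy x hxg (hypCosh_comm x y ▸ hxy))).le
  · rw [image_eq_zero_of_notMem_tsupport hxg, image_eq_zero_of_notMem_tsupport hyg, dist_self]
    exact hη.le

lemma integrable_hypKernel_mul (hg : Continuous g) (hgc : HasCompactSupport g)
    (hy : y ∈ hypSpace d) (ht : 0 < t) :
    Integrable (fun x => hypKernel x y t * g x) (hypVolume d) := by
  obtain ⟨M, hM⟩ := hgc.exists_bound_of_continuous hg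
  exact (integrable_hypKernel hy ht).mul_bdd hg.aestronglyMeasurable (ae_of_all _ hM)

lemma integral_hypKernel_mul_sub (hg : Continuous g) (hgc : HasCompactSupport g)
    (hy : y ∈ hypSpace d) (ht : 0 < t) :
    ∫ x, hypKernel x y t * g x ∂hypVolume d - g y =
      ∫ x, hypKernel x y t * (g x - g y) ∂hypVolume d := by
  simp_rw [mul_sub]
  rw [integral_sub (integrable_hypKernel_mul hg hgc hy ht)
    ((integrable_hypKernel hy ht).mul_const _), integral_mul_const, integral_hypKernel hy ht,
    one_mul]

lemma abs_integral_hypKernel_mul_sub_le (hg : Continuous g) (hgc : HasCompactSupport g) {δ ε M : ℝ}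
    (hε : 0 ≤ ε) (hgδ : ∀ x ∈ hypSpace d, hypCosh x y < 1 + δ → |g x - g y| ≤ ε)
    (hgM : ∀ x, |g x - g y| ≤ M) (hy : y ∈ hypSpace d) (ht : 0 < t) :
    |∫ x, hypKernel x y t * g x ∂hypVolume d - g y| ≤
      ε + M * ∫ x in {x | 1 + δ ≤ hypCosh x y}, hypKernel x y t ∂hypVolume d := by
  have hker := integrable_hypKernel hy ht
  set far := {x | 1 + δ ≤ hypCosh x y}
  have hfar : MeasurableSet far := measurableSet_le_hypCosh _ y
  have hbound : ∀ᵐ x ∂hypVolume d, ‖hypKernel x y t * (g x - g y)‖ ≤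
      ε * hypKernel x y t + M * far.indicator (hypKernel · y t) x := by
    filter_upwards [ae_mem_hypSpace] with x hx
    have hpos := hypKernel_pos hx hy ht
    rw [norm_mul, Real.norm_of_nonneg hpos.le, Real.norm_eq_abs, mul_comm]
    by_cases hxy : x ∈ far
    · rw [indicator_of_mem hxy]
      nlinarith [hgM x]
    · rw [indicator_of_notMem hxy, mul_zero, add_zero]
      exact mul_le_mul_of_nonneg_right (hgδ x hx (not_le.1 hxy)) hpos.le
  have hnear := hker.const_mul ε
  have hind := (hker.indicator hfar).const_mul M
  rw [integral_hypKernel_mul_sub hg hgc hy ht, ← Real.norm_eq_abs]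
  refine (norm_integral_le_of_norm_le (hnear.add hind) hbound).trans_eq ?_
  rw [integral_add' hnear hind, integral_const_mul, integral_const_mul, integral_hypKernel hy ht,
    mul_one, integral_indicator hfar]

lemma eventually_abs_integral_hypKernel_mul_sub_le (hg : Continuous g) (hgc : HasCompactSupport g)
    (hgs : tsupport g ⊆ hypSpace d) {η : ℝ} (hη : 0 < η) :
    ∀ᶠ t in 𝓝[>] (0 : ℝ), ∀ y ∈ hypSpace d,
      |∫ x, hypKernel x y t * g x ∂hypVolume d - g y| ≤ η := by
  obtain ⟨M, hM⟩ := hgc.exists_bound_of_continuous hg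
  have hM0 : 0 ≤ M := (norm_nonneg _).trans (hM 0)
  have hosc x y : |g x - g y| ≤ 2 * M :=
    (abs_sub _ _).trans ((add_le_add (hM x) (hM y)).trans_eq (two_mul M).symm)
  obtain ⟨δ, hδ, hgδ⟩ := exists_forall_abs_sub_le_of_hypCosh_lt hg hgc hgs (half_pos hη)
  filter_upwards [eventually_integral_hypKernel_far_le (d := d) hδ
    (by positivity : 0 < η / 2 / (2 * M + 1)), self_mem_nhdsWithin] with t hfar ht y hy
  calc |∫ x, hypKernel x y t * g x ∂hypVolume d - g y|
      ≤ η / 2 + 2 * M * ∫ x in {x | 1 + δ ≤ hypCosh x y}, hypKernel x y t ∂hypVolume d :=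
        abs_integral_hypKernel_mul_sub_le hg hgc (half_pos hη).le
          (fun x hx => hgδ x hx y hy) (hosc · y) hy ht
    _ ≤ η / 2 + 2 * M * (η / 2 / (2 * M + 1)) := by
        gcongr
        exact hfar y hy
    _ ≤ η / 2 + (2 * M + 1) * (η / 2 / (2 * M + 1)) := by gcongr; linarith
    _ = η := by rw [mul_div_cancel₀ _ (by positivity), add_halves]

lemma isFundamentalSolution_hypKernel : IsFundamentalSolution d hypKernel where
  continuousOn := continuousOn_hypKernel
  contDiffOn_space := fun _ hy _ ht => contDiffOn_hypKernel hy ht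
  contDiffOn_time := fun _ hx _ hy => contDiffOn_hypKernel_time hx hy
  nonneg := fun _ hx _ hy _ ht => (hypKernel_pos hx hy ht).le
  heat_eq := fun x hx y hy t ht => by
    rw [(hasDerivAt_hypKernel_time hx hy ht).deriv]
    exact (hasLaplacianAt_hypKernel hx hy ht).unique
      (hasLaplacianAt_laplaceBeltrami (contDiffOn_hypKernel hy ht) hx)
  tendsto_dirac := fun y hy f hf hfc hfs => by
    refine Metric.tendsto_nhds.2 fun η hη => ?_
    filter_upwards [eventually_abs_integral_hypKernel_mul_sub_le hf hfc hfs (half_pos hη)]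
      with t ht
    exact (ht y hy).trans_lt (half_lt_self hη)

namespace IsFundamentalSolution

variable {K K' : Coord d → Coord d → ℝ → ℝ}

lemma hasDerivAt_time (hK : IsFundamentalSolution d K) (hx : x ∈ hypSpace d)
    (hy : y ∈ hypSpace d) (ht : 0 < t) :
    HasDerivAt (K x y) (laplaceBeltrami (hypMetric d) (K · y t) x) t := by
  rw [← hK.heat_eq x hx y hy t ht]
  exact (((hK.contDiffOn_time x hx y hy).contDiffAt (Ioi_mem_nhds ht)).differentiableAt
    one_ne_zero).hasDerivAt

lemma congr (hK : IsFundamentalSolution d K)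
    (h : ∀ x ∈ hypSpace d, ∀ y ∈ hypSpace d, ∀ t : ℝ, 0 < t → K' x y t = K x y t) :
    IsFundamentalSolution d K' where
  continuousOn := hK.continuousOn.congr fun q hq => h _ hq.1 _ hq.2.1 _ hq.2.2
  contDiffOn_space := fun y hy t ht =>
    (hK.contDiffOn_space y hy t ht).congr fun x hx => h x hx y hy t ht
  contDiffOn_time := fun x hx y hy =>
    (hK.contDiffOn_time x hx y hy).congr fun t ht => h x hx y hy t ht
  nonneg := fun x hx y hy t ht => (hK.nonneg x hx y hy t ht).trans_eq (h x hx y hy t ht).symm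
  heat_eq := fun x hx y hy t ht => by
    have htime : (fun s => K' x y s) =ᶠ[𝓝 t] fun s => K x y s :=
      eventually_of_mem (Ioi_mem_nhds ht) fun s hs => h x hx y hy s hs
    have hspace : (fun z => K' z y t) =ᶠ[𝓝 x] fun z => K z y t :=
      eventually_of_mem (isOpen_hypSpace.mem_nhds hx) fun z hz => h z hz y hy t ht
    have hK_contDiffOn := hK.contDiffOn_space y hy t ht
    rw [htime.deriv_eq, hK.heat_eq x hx y hy t ht]
    exact ((hasLaplacianAt_laplaceBeltrami hK_contDiffOn hx).congr_of_eventuallyEq hspace).unique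
      (hasLaplacianAt_laplaceBeltrami
        (hK_contDiffOn.congr fun z hz => h z hz y hy t ht) hx)
  tendsto_dirac := fun y hy f hf hfc hfs => by
    refine (hK.tendsto_dirac y hy f hf hfc hfs).congr' ?_
    filter_upwards [self_mem_nhdsWithin] with t ht
    refine integral_congr_ae ?_
    filter_upwards [ae_mem_hypSpace] with x hx
    rw [h x hx y hy t ht]

end IsFundamentalSolution

end Dirac

/-! ### The heat flow of a test function -/

section ParametricIntegral

variable {E F Z : Type*} [NormedAddCommGroup E] [NormedSpace ℝ E] [NormedAddCommGroup F]
  [NormedSpace ℝ F] [TopologicalSpace Z] [T2Space Z] [MeasurableSpace Z] [BorelSpace Z]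
  {μ : Measure Z} {K : Set Z}

lemma continuousOn_setIntegral {X : Type*} [TopologicalSpace X] [LocallyCompactSpace X]
    [FirstCountableTopology X] {V : Set X} {f : X → Z → E} (hV : IsOpen V) (hK : IsCompact K)
    (hμ : μ K ≠ ⊤) (hf : ContinuousOn ↿f (V ×ˢ K)) :
    ContinuousOn (fun x => ∫ z in K, f x z ∂μ) V := by
  intro x hx
  have hae {P : Z → Prop} (hP : ∀ z ∈ K, P z) : ∀ᵐ z ∂μ.restrict K, P z :=
    (ae_restrict_iff' hK.measurableSet).2 (ae_of_all _ hP)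
  obtain ⟨N, hN, hNV, hNc⟩ := local_compact_nhds (hV.mem_nhds hx)
  obtain ⟨C, hC⟩ := (hNc.prod hK).exists_bound_of_continuousOn (hf.mono (prod_mono hNV le_rfl))
  refine (continuousAt_of_dominated (bound := fun _ => C) ?_ ?_ (integrableOn_const hμ)
    ?_).continuousWithinAt
  · filter_upwards [hV.mem_nhds hx] with v hv
    exact (hf.comp (f := fun z => (v, z)) (by fun_prop)
      fun z hz => ⟨hv, hz⟩).aestronglyMeasurable_of_isCompact hK hK.measurableSet
  · filter_upwards [hN] with v hv using hae fun z hz => hC (v, z) ⟨hv, hz⟩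
  · exact hae fun z hz => (hf.comp (f := fun v => (v, z)) (s := V) (by fun_prop)
      fun v hv => ⟨hv, hz⟩).continuousAt (hV.mem_nhds hx)

lemma hasLineDerivAt_setIntegral {U : Set E} {f f' : E → Z → F} {x v : E} (hU : IsOpen U)
    (hx : x ∈ U) (hK : IsCompact K) (hμ : μ K ≠ ⊤) (hf : ContinuousOn ↿f (U ×ˢ K))
    (hf' : ContinuousOn ↿f' (U ×ˢ K))
    (hderiv : ∀ x ∈ U, ∀ z ∈ K, HasLineDerivAt ℝ (f · z) (f' x z) x v) :
    HasLineDerivAt ℝ (fun x => ∫ z in K, f x z ∂μ) (∫ z in K, f' x z ∂μ) x v := by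
  have hline {h : E → Z → F} (hh : ContinuousOn ↿h (U ×ˢ K)) :
      ContinuousOn ↿(fun (s : ℝ) z => h (x + s • v) z) ({s : ℝ | x + s • v ∈ U} ×ˢ K) :=
    hh.comp (f := fun q : ℝ × Z => (x + q.1 • v, q.2)) (by fun_prop) fun q hq => ⟨hq.1, hq.2⟩
  have h := hasDerivAt_setIntegral_of_continuousOn (s₀ := 0) (hU.preimage (by fun_prop))
    (by simpa using hx) hK hμ (hline hf) (hline hf')
    fun s hs z hz => hasDerivAt_comp_add_smul (hderiv _ hs z hz)
  simpa only [HasLineDerivAt, zero_smul, add_zero] using h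

end ParametricIntegral

section HeatFlow

variable {d : ℕ} [NeZero d] {x : Coord d}

lemma hasLaplacianAt_setIntegral {Z : Type*} [TopologicalSpace Z] [T2Space Z] [MeasurableSpace Z]
    [BorelSpace Z] {μ : Measure Z} {K : Set Z} {f : Coord d → Z → ℝ}
    {D D₂ : Fin d → Coord d → Z → ℝ} (hK : IsCompact K) (hμ : μ K ≠ ⊤)
    (hf : ContinuousOn ↿f (hypSpace d ×ˢ K)) (hD : ∀ i, ContinuousOn ↿(D i) (hypSpace d ×ˢ K))
    (hD₂ : ∀ i, ContinuousOn ↿(D₂ i) (hypSpace d ×ˢ K))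
    (hfD : ∀ i, ∀ x ∈ hypSpace d, ∀ z ∈ K,
      HasLineDerivAt ℝ (f · z) (D i x z) x (EuclideanSpace.single i 1))
    (hDD₂ : ∀ i, ∀ x ∈ hypSpace d, ∀ z ∈ K,
      HasLineDerivAt ℝ (D i · z) (D₂ i x z) x (EuclideanSpace.single i 1))
    (hx : x ∈ hypSpace d) :
    HasLaplacianAt (fun x => ∫ z in K, f x z ∂μ)
      (∫ z in K, (x 0 ^ 2 * ∑ i, D₂ i x z + (2 - d) * x 0 * D 0 x z) ∂μ) x := by
  have hint {h : Coord d → Z → ℝ} (hh : ContinuousOn ↿h (hypSpace d ×ˢ K)) :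
      Integrable (h x) (μ.restrict K) := by
    have hhx : ContinuousOn (h x) K :=
      hh.comp (f := fun z => (x, z)) (by fun_prop) fun z hz => ⟨hx, hz⟩
    obtain ⟨C, hC⟩ := hK.exists_bound_of_continuousOn hhx
    exact (integrableOn_const (C := C) hμ).mono'
      (hhx.aestronglyMeasurable_of_isCompact hK hK.measurableSet)
      ((ae_restrict_iff' hK.measurableSet).2 (ae_of_all _ hC))
  refine ⟨fun i x => ∫ z in K, D i x z ∂μ, fun i => ∫ z in K, D₂ i x z ∂μ, fun i => ?_, fun i =>
    hasLineDerivAt_setIntegral isOpen_hypSpace hx hK hμ (hD i) (hD₂ i) (hDD₂ i), ?_⟩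
  · filter_upwards [isOpen_hypSpace.mem_nhds hx] with z hz
    exact hasLineDerivAt_setIntegral isOpen_hypSpace hz hK hμ hf (hD i) (hfD i)
  · have hsum := integrable_finsetSum Finset.univ fun i _ => hint (hD₂ i)
    rw [integral_add (hsum.const_mul _) ((hint (hD 0)).const_mul _), integral_const_mul,
      integral_const_mul, integral_finsetSum _ fun i _ => hint (hD₂ i)]

/-- The solution of the heat equation with initial value `g`, at the point `x` and time `t`. -/
def heatFlow (g : Coord d → ℝ) (x : Coord d) (t : ℝ) : ℝ :=
  ∫ z, hypKernel z x t * g z ∂hypVolume d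

variable {t : ℝ} {g : Coord d → ℝ}

lemma heatFlow_eq_setIntegral (g : Coord d → ℝ) (x : Coord d) (t : ℝ) :
    heatFlow g x t = ∫ z in tsupport g, hypKernel x z t * g z ∂hypVolume d := by
  rw [setIntegral_eq_integral_of_forall_compl_eq_zero fun z hz => by
    rw [image_eq_zero_of_notMem_tsupport hz, mul_zero]]
  simp only [heatFlow, hypKernel_comm x]

lemma continuousOn_kernel_mul_tsupport {X : Type*} [TopologicalSpace X] {V : Set X}
    {a : X → Coord d} {b : X → ℝ} {f : Coord d → Coord d → ℝ → ℝ} (hg : Continuous g)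
    (hgs : tsupport g ⊆ hypSpace d) (hf : ContinuousOn ↿f (kernelDomain d)) (ha : Continuous a)
    (hb : Continuous b) (haV : MapsTo a V (hypSpace d)) (hbV : MapsTo b V (Ioi 0)) :
    ContinuousOn ↿(fun v z => f (a v) z (b v) * g z) (V ×ˢ tsupport g) :=
  (hf.comp (f := fun q : X × Coord d => (a q.1, q.2, b q.1)) (by fun_prop)
    fun _ hq => ⟨haV hq.1, hgs hq.2, hbV hq.1⟩).mul (by fun_prop)

lemma hasDerivAt_heatFlow_time (hg : Continuous g) (hgc : HasCompactSupport g)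
    (hgs : tsupport g ⊆ hypSpace d) (hx : x ∈ hypSpace d) (ht : 0 < t) :
    HasDerivAt (heatFlow g x)
      (∫ z in tsupport g, hypKernelTimeDeriv x z t * g z ∂hypVolume d) t := by
  have hcont {f : Coord d → Coord d → ℝ → ℝ} (hf : ContinuousOn ↿f (kernelDomain d)) :
      ContinuousOn ↿(fun t z => f x z t * g z) (Ioi 0 ×ˢ tsupport g) :=
    continuousOn_kernel_mul_tsupport hg hgs hf continuous_const continuous_id (fun _ _ => hx)
      (mapsTo_id _)
  simp only [funext (heatFlow_eq_setIntegral g x)]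
  exact hasDerivAt_setIntegral_of_continuousOn isOpen_Ioi ht hgc.isCompact
    (hypVolume_ne_top hgc.isCompact hgs) (hcont continuousOn_hypKernel)
    (hcont continuousOn_hypKernelTimeDeriv)
    fun s hs z hz => (hasDerivAt_hypKernel_time hx (hgs hz) hs).mul_const (g z)

lemma hasLaplacianAt_heatFlow (hg : Continuous g) (hgc : HasCompactSupport g)
    (hgs : tsupport g ⊆ hypSpace d) (hx : x ∈ hypSpace d) (ht : 0 < t) :
    HasLaplacianAt (heatFlow g · t)
      (∫ z in tsupport g, hypKernelTimeDeriv x z t * g z ∂hypVolume d) x := by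
  have hcont {f : Coord d → Coord d → ℝ → ℝ} (hf : ContinuousOn ↿f (kernelDomain d)) :
      ContinuousOn ↿(fun x z => f x z t * g z) (hypSpace d ×ˢ tsupport g) :=
    continuousOn_kernel_mul_tsupport hg hgs hf continuous_id continuous_const (mapsTo_id _)
      fun _ _ => ht
  simp only [heatFlow_eq_setIntegral]
  convert hasLaplacianAt_setIntegral hgc.isCompact (hypVolume_ne_top hgc.isCompact hgs)
    (hcont continuousOn_hypKernel)
    (fun i => hcont (continuousOn_hypKernelDeriv (EuclideanSpace.single i 1)))
    (fun i => hcont (continuousOn_hypKernelDeriv₂ (EuclideanSpace.single i 1)))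
    (fun i x hx z hz => HasDerivAt.mul_const (hasLineDerivAt_hypKernel _ hx (hgs hz) ht) (g z))
    (fun i x hx z hz => HasDerivAt.mul_const (hasLineDerivAt_hypKernelDeriv _ hx (hgs hz) ht) (g z))
    hx using 1
  refine setIntegral_congr_fun hgc.isCompact.measurableSet fun z hz => ?_
  simp only [← sum_hypKernelDeriv₂ hx (hgs hz) t, ← Finset.sum_mul]
  ring

lemma continuousOn_heatFlow (hg : Continuous g) (hgc : HasCompactSupport g)
    (hgs : tsupport g ⊆ hypSpace d) : ContinuousOn ↿(heatFlow g) (hypSpace d ×ˢ Ioi 0) := by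
  refine (continuousOn_setIntegral (isOpen_hypSpace.prod isOpen_Ioi) hgc.isCompact
    (hypVolume_ne_top hgc.isCompact hgs) (continuousOn_kernel_mul_tsupport hg hgs
      continuousOn_hypKernel continuous_fst continuous_snd (fun _ h => h.1)
      fun _ h => h.2)).congr fun q _ => heatFlow_eq_setIntegral g q.1 q.2

lemma exists_isCompact_heatFlow_le (hg : Continuous g) (hgc : HasCompactSupport g)
    (hgs : tsupport g ⊆ hypSpace d) {t₁ t₂ η : ℝ} (h₁ : 0 < t₁) (hη : 0 < η) :
    ∃ C ⊆ hypSpace d, IsCompact C ∧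
      ∀ x ∈ hypSpace d \ C, ∀ t ∈ Icc t₁ t₂, heatFlow g x t ≤ η := by
  obtain ⟨A, hA0, hA⟩ := hasDecay_profile d 1 t₁ t₂ h₁
  obtain ⟨M, hM⟩ := hgc.exists_bound_of_continuous hg
  have hM0 : 0 ≤ M := (norm_nonneg _).trans (hM 0)
  have hμ := hypVolume_ne_top hgc.isCompact hgs
  set B := A * M * (hypVolume d).real (tsupport g)
  have : 0 ≤ B := mul_nonneg (mul_nonneg hA0 hM0) measureReal_nonneg
  obtain ⟨C, hCH, hC, hfar⟩ := exists_isCompact_lt_hypCosh hgc.isCompact hgs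
    (by positivity : 0 < B / η + 1)
  refine ⟨C, hCH, hC, fun x hx t ⟨ht₁, ht₂⟩ => ?_⟩
  have ht : 0 < t := h₁.trans_le ht₁
  have hbound : ∀ z ∈ tsupport g, ‖hypKernel x z t * g z‖ ≤ A / (B / η + 1) * M := by
    intro z hz
    have hpos := hypKernel_pos hx.1 (hgs hz) ht
    rw [norm_mul, Real.norm_of_nonneg hpos.le]
    refine mul_le_mul ?_ (hM z) (norm_nonneg _) (by positivity)
    calc hypKernel x z t ≤ |profile d (hypCosh x z) t| :=
          (mul_le_of_le_one_left (profile_pos d (hypCosh_pos hx.1 (hgs hz)) ht).le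
            (Real.exp_le_one_iff.2 (by nlinarith [sq_nonneg (((d : ℝ) - 1) / 2)]))).trans
            (le_abs_self _)
      _ ≤ A / (1 + hypCosh x z) ^ 1 := hA _ _ (hypCosh_pos hx.1 (hgs hz)) ht₁ ht₂
      _ ≤ A / (B / η + 1) := by
          rw [pow_one]
          exact div_le_div_of_nonneg_left hA0 (by positivity) (by linarith [hfar x hx z hz])
  rw [heatFlow_eq_setIntegral]
  calc _ ≤ A / (B / η + 1) * M * (hypVolume d).real (tsupport g) :=
        (le_abs_self _).trans (norm_setIntegral_le_of_norm_le_const hμ.lt_top hbound)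
    _ = B / (B / η + 1) := by ring
    _ ≤ η := by
        rw [div_le_iff₀ (by positivity), mul_add, mul_div_cancel₀ _ hη.ne']
        linarith

end HeatFlow

/-! ### Minimality -/

section Minima

lemma exists_isMinOn_of_forall_diff_le {α β : Type*} [TopologicalSpace α] [TopologicalSpace β]
    [LinearOrder β] [ClosedIicTopology β] {f : α → β} {s C : Set α} {a : α} (hf : ContinuousOn f s)
    (ha : a ∈ s) (hC : IsCompact C) (hCs : C ⊆ s) (hfa : ∀ x ∈ s \ C, f a ≤ f x) :
    ∃ x ∈ s, IsMinOn f s x := by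
  have hsub : insert a C ⊆ s := insert_subset ha hCs
  obtain ⟨x, hx, hmin⟩ := (hC.insert a).exists_isMinOn (insert_nonempty a C) (hf.mono hsub)
  refine ⟨x, hsub hx, fun z hz => ?_⟩
  by_cases hzC : z ∈ C
  · exact hmin (mem_insert_of_mem a hzC)
  · exact (hmin (mem_insert a C)).trans (hfa z ⟨hz, hzC⟩)

lemma hasDerivAt_nonpos_of_isMinOn_Icc {f : ℝ → ℝ} {f' a b : ℝ} (hab : a < b)
    (hf : HasDerivAt f f' b) (hmin : IsMinOn f (Icc a b) b) : f' ≤ 0 := by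
  have hcone : a - b ∈ posTangentConeAt (Icc a b) b :=
    sub_mem_posTangentConeAt_of_segment_subset ((convex_Icc a b).segment_subset
      (right_mem_Icc.2 hab.le) (left_mem_Icc.2 hab.le))
  have h : 0 ≤ (a - b) * f' := by
    simpa using hmin.localize.hasFDerivWithinAt_nonneg hf.hasFDerivAt.hasFDerivWithinAt hcone
  exact nonpos_of_mul_nonneg_right h (sub_neg.2 hab)

lemma tendsto_comp_const_add {M X : Type*} [TopologicalSpace M] [AddZeroClass M] [ContinuousAdd M]
    [TopologicalSpace X] {f : M → X} {a : M} (hf : ContinuousAt f a) (s : Set M) :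
    Tendsto (fun ε => f (a + ε)) (𝓝[s] 0) (𝓝 (f a)) :=
  hf.tendsto.comp ((Continuous.tendsto' (by fun_prop) _ _ (add_zero a)).mono_left
    nhdsWithin_le_nhds)

end Minima

section MinimumPrinciple

variable {d : ℕ} [NeZero d] {x : Coord d} {t T : ℝ} {E : Coord d → ℝ → ℝ}

lemma deriv_le_laplacian_of_isMinOn {L L' : ℝ} (hx : x ∈ hypSpace d) (ht : t ∈ Ioc 0 T)
    (hmin : IsMinOn ↿E (hypSpace d ×ˢ Icc 0 T) (x, t)) (hL : HasLaplacianAt (E · t) L x)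
    (hL' : HasDerivAt (E x) L' t) : L' ≤ L := by
  have hspace : IsLocalMin (E · t) x := by
    filter_upwards [isOpen_hypSpace.mem_nhds hx] with z hz
    exact hmin (show (z, t) ∈ hypSpace d ×ˢ Icc 0 T from ⟨hz, Ioc_subset_Icc_self ht⟩)
  have htime : IsMinOn (E x) (Icc 0 t) t := fun s hs =>
    hmin (show (x, s) ∈ hypSpace d ×ˢ Icc 0 T from ⟨hx, hs.1, hs.2.trans ht.2⟩)
  exact (hasDerivAt_nonpos_of_isMinOn_Icc ht.1 hL' htime).trans (hL.nonneg_of_isLocalMin hspace)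

lemma heat_minimum_principle {m : ℝ} (hcont : ContinuousOn ↿E (hypSpace d ×ˢ Icc 0 T))
    (hheat : ∀ x ∈ hypSpace d, ∀ t ∈ Ioc 0 T,
      ∃ L, HasLaplacianAt (E · t) L x ∧ HasDerivAt (E x) L t)
    (hinit : ∀ x ∈ hypSpace d, m ≤ E x 0)
    (hinf : ∀ η < m, ∃ C ⊆ hypSpace d, IsCompact C ∧
      ∀ x ∈ hypSpace d \ C, ∀ t ∈ Icc 0 T, η ≤ E x t) :
    ∀ x ∈ hypSpace d, ∀ t ∈ Icc 0 T, m ≤ E x t := by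
  intro x₁ hx₁ t₁ ht₁
  by_contra! hlt
  -- Adding `σ t` makes the function a strict supersolution.
  obtain ⟨σ, hσ, hσm⟩ := exists_pos_mul_lt (sub_pos.2 hlt) t₁
  set F : Coord d → ℝ → ℝ := fun x t => E x t + σ * t
  have hF₁ : F x₁ t₁ < m := by linarith
  obtain ⟨C, hCH, hC, hout⟩ := hinf _ hF₁
  have hFcont : ContinuousOn ↿F (hypSpace d ×ˢ Icc 0 T) :=
    hcont.add (Continuous.continuousOn (by fun_prop : Continuous fun q : Coord d × ℝ => σ * q.2))
  obtain ⟨⟨x, t⟩, ⟨hx, ht⟩, hmin⟩ := exists_isMinOn_of_forall_diff_le hFcont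
    (a := (x₁, t₁)) ⟨hx₁, ht₁⟩ (hC.prod isCompact_Icc) (prod_mono hCH le_rfl) fun q hq =>
      (hout q.1 ⟨hq.1.1, fun hqC => hq.2 ⟨hqC, hq.1.2⟩⟩ q.2 hq.1.2).trans
        (le_add_of_nonneg_right (mul_nonneg hσ.le hq.1.2.1))
  have hle : F x t ≤ F x₁ t₁ := hmin (show (x₁, t₁) ∈ hypSpace d ×ˢ Icc 0 T from ⟨hx₁, ht₁⟩)
  have htpos : 0 < t := ht.1.lt_of_ne' <| by
    rintro rfl
    have := hinit x hx
    simp only [F, mul_zero, add_zero] at hle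
    linarith
  obtain ⟨L, hL, hLt⟩ := hheat x hx t ⟨htpos, ht.2⟩
  have hderiv : HasDerivAt (F x) (L + σ) t :=
    hLt.add (hasDerivAt_const_mul σ)
  linarith [deriv_le_laplacian_of_isMinOn hx ⟨htpos, ht.2⟩ hmin (hL.add_const _) hderiv]

variable {K : Coord d → Coord d → ℝ → ℝ} {y : Coord d} {g : Coord d → ℝ} {s : ℝ}

lemma heatFlow_add_sub_le {ε η : ℝ} (hK : IsFundamentalSolution d K) (hy : y ∈ hypSpace d)
    (hs : 0 < s) (hg : Continuous g) (hgc : HasCompactSupport g) (hgs : tsupport g ⊆ hypSpace d)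
    (hε : 0 < ε) (hη : 0 ≤ η) (hinit : ∀ x ∈ hypSpace d, heatFlow g x ε - η ≤ K x y s)
    (hx : x ∈ hypSpace d) (ht : 0 ≤ t) : heatFlow g x (t + ε) - η ≤ K x y (t + s) := by
  suffices -η ≤ K x y (t + s) - heatFlow g x (t + ε) by linarith
  refine heat_minimum_principle (E := fun x τ => K x y (τ + s) - heatFlow g x (τ + ε)) ?_ ?_
    (fun z hz => by simpa using by linarith [hinit z hz]) ?_ x hx t ⟨ht, le_rfl⟩
  · exact (hK.continuousOn.comp (f := fun q : Coord d × ℝ => (q.1, y, q.2 + s)) (by fun_prop)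
      fun q hq => ⟨hq.1, hy, add_pos_of_nonneg_of_pos hq.2.1 hs⟩).sub
      ((continuousOn_heatFlow hg hgc hgs).comp (f := fun q : Coord d × ℝ => (q.1, q.2 + ε))
        (by fun_prop) fun q hq => ⟨hq.1, add_pos_of_nonneg_of_pos hq.2.1 hε⟩)
  · rintro z hz τ ⟨hτ, -⟩
    have hτs := add_pos hτ hs
    have hτε := add_pos hτ hε
    exact ⟨_, (hasLaplacianAt_laplaceBeltrami (hK.contDiffOn_space y hy _ hτs) hz).sub
      (hasLaplacianAt_heatFlow hg hgc hgs hz hτε),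
      ((hK.hasDerivAt_time hz hy hτs).comp_add_const τ s).sub
        ((hasDerivAt_heatFlow_time hg hgc hgs hz hτε).comp_add_const τ ε)⟩
  · intro m hm
    obtain ⟨C, hCH, hC, hout⟩ :=
      exists_isCompact_heatFlow_le hg hgc hgs (t₂ := t + ε) hε (show 0 < -m by linarith)
    refine ⟨C, hCH, hC, fun z hz τ ⟨hτ, hτt⟩ => ?_⟩
    have hflow := hout z hz (τ + ε) ⟨by linarith, by linarith⟩
    have hnonneg := hK.nonneg z hz.1 y hy (τ + s) (by linarith)
    linarith

lemma heatFlow_le_of_le (hK : IsFundamentalSolution d K) (hy : y ∈ hypSpace d) (hs : 0 < s)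
    (hg : Continuous g) (hgc : HasCompactSupport g) (hgs : tsupport g ⊆ hypSpace d)
    (hgK : ∀ x ∈ hypSpace d, g x ≤ K x y s) (hx : x ∈ hypSpace d) (ht : 0 < t) :
    heatFlow g x t ≤ K x y (t + s) := by
  refine le_of_forall_pos_le_add fun η hη => ?_
  refine le_of_tendsto (tendsto_comp_const_add
    (hasDerivAt_heatFlow_time hg hgc hgs hx ht).continuousAt (Ioi 0)) ?_
  filter_upwards [eventually_abs_integral_hypKernel_mul_sub_le hg hgc hgs hη, self_mem_nhdsWithin]
    with ε hflow hε
  refine sub_le_iff_le_add.1 (heatFlow_add_sub_le hK hy hs hg hgc hgs hε hη.le (fun z hz => ?_)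
    hx ht.le)
  have hz_flow : heatFlow g z ε - g z ≤ η := (abs_le.1 (hflow z hz)).2
  linarith [hgK z hz]

lemma hypKernel_le (hK : IsFundamentalSolution d K) (hx : x ∈ hypSpace d) (hy : y ∈ hypSpace d)
    (ht : 0 < t) : hypKernel x y t ≤ K x y t := by
  obtain ⟨φ, hφ, hφc, hφs, hφ01⟩ := exists_continuousMap_one_of_isCompact_subset_isOpen
    isCompact_singleton isOpen_hypSpace (singleton_subset_iff.2 hy)
  have hcutoff {f : Coord d → ℝ} (hf : ContinuousOn f (hypSpace d)) :
      Continuous (fun z => φ z * f z) ∧ HasCompactSupport (fun z => φ z * f z) ∧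
        tsupport (fun z => φ z * f z) ⊆ hypSpace d := by
    have hsupp : tsupport (fun z => φ z * f z) ⊆ hypSpace d :=
      tsupport_mul_subset_left.trans hφs
    exact ⟨(φ.continuous.continuousOn.mul hf).continuous_of_tsupport_subset isOpen_hypSpace hsupp,
      HasCompactSupport.mul_right hφc, hsupp⟩
  have hdirac : Tendsto (fun s => ∫ z, K z y s * (φ z * hypKernel z x t) ∂hypVolume d) (𝓝[>] 0)
      (𝓝 (hypKernel x y t)) := by
    obtain ⟨hc, hcs, hsupp⟩ := hcutoff (continuousOn_hypKernel_left hx ht)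
    simpa only [hφ (mem_singleton y), Pi.one_apply, one_mul, hypKernel_comm y x] using
      hK.tendsto_dirac y hy _ hc hcs hsupp
  have hlim : Tendsto (fun s => K x y (t + s)) (𝓝[>] 0) (𝓝 (K x y t)) :=
    tendsto_comp_const_add (hK.hasDerivAt_time hx hy ht).continuousAt (Ioi 0)
  refine le_of_tendsto_of_tendsto hdirac hlim ?_
  filter_upwards [self_mem_nhdsWithin] with s hs
  obtain ⟨hc, hcs, hsupp⟩ := hcutoff (hK.contDiffOn_space y hy s hs).continuousOn
  calc ∫ z, K z y s * (φ z * hypKernel z x t) ∂hypVolume d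
      = heatFlow (fun z => φ z * K z y s) x t := by
        simp only [heatFlow, mul_left_comm, mul_comm]
    _ ≤ K x y (t + s) := heatFlow_le_of_le hK hy hs hc hcs hsupp
        (fun z hz => mul_le_of_le_one_left (hK.nonneg z hz y hy s hs) (hφ01 z).2) hx ht

lemma isHeatKernel_iff : IsHeatKernel d K ↔ ∀ x ∈ hypSpace d, ∀ y ∈ hypSpace d, ∀ t : ℝ, 0 < t →
    K x y t = hypKernel x y t := by
  refine ⟨fun h x hx y hy t ht => le_antisymm
    (h.minimal _ isFundamentalSolution_hypKernel x hx y hy t ht)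
    (hypKernel_le h.isFundamentalSolution hx hy ht),
    fun h => ⟨isFundamentalSolution_hypKernel.congr h, fun K' hK' x hx y hy t ht => ?_⟩⟩
  rw [h x hx y hy t ht]
  exact hypKernel_le hK' hx hy ht

end MinimumPrinciple

end HypHeat

end

theorem mainTheorem5 (d : ℕ) [NeZero d] :
    ∃ p : ℝ → ℝ → ℝ,
      (∀ K : HypHeat.Coord d → HypHeat.Coord d → ℝ → ℝ,
        HypHeat.IsHeatKernel d K ↔
          ∀ x ∈ HypHeat.hypSpace d, ∀ y ∈ HypHeat.hypSpace d, ∀ t : ℝ, 0 < t →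
            K x y t = p (HypHeat.hypDist d x y) t) ∧
      ∀ t : ℝ, 0 < t → StrictAntiOn (fun ρ => p ρ t) (Set.Ici 0) := by
  refine ⟨fun ρ t => Real.exp (-((d - 1) / 2 : ℝ) ^ 2 * t) * HypHeat.profile d (Real.cosh ρ) t,
    fun K => ?_, fun t ht ρ hρ r hr hρr => ?_⟩
  · refine HypHeat.isHeatKernel_iff.trans ?_
    refine forall₂_congr fun x hx => forall₂_congr fun y hy => forall₂_congr fun t _ => ?_
    simp only [HypHeat.hypKernel, HypHeat.cosh_hypDist hx hy]
  · have hcosh : Real.cosh ρ < Real.cosh r := by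
      rwa [Real.cosh_lt_cosh, abs_of_nonneg hρ, abs_of_nonneg hr]
    exact mul_lt_mul_of_pos_left (HypHeat.strictAntiOn_profile d ht (Real.cosh_pos ρ)
      (Real.cosh_pos r) hcosh) (Real.exp_pos _)
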